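/- For a metric space $(M,d)$ and a Banach space $X$ let $Lip(M,X)$ be the space of Lipschitz functions $f:M\to X$ with the seminorm $L(f)=\sup_{m\ne m'}\|f(m)-f(m')\|/d(m,m')$. For $S\subset M$ (with the induced metric) let $\lambda(S,M;X)$ be the infimum of the norms $\|T\|$ over all continuous linear operators $T:Lip(S,X)\to Lip(M,X)$ with $Tf|_S=f$ for all $f$ (and $\infty$ if there is none). Write $B_R(m)$ for the open ball of radius $R$ centred at $m$. A metric space $(M,d)$ is of pointwise homogeneous type with respect to a family $\{\mu_m\}_{m\in M}$ of Borel measures on $M$ if every ball $B_R(m)$, $m\in M$, $R>0$, has finite and strictly positive $\mu_m$-measure, $$D:=\sup_{m\in M}\sup_{R>0}\frac{\mu_m(B_{2R}(m))}{\mu_m(B_R(m))}<\infty ,$$ and for some constant $C\ge 0$, for all $m_1,m_2\in M$ and $R>0$, $$|\mu_{m_1}-\mu_{m_2}|(B_R(m))\le C\,\frac{\mu_m(B_R(m))}{R}\,d(m_1,m_2)\qquad\text{for } m=m_1 \text{ and for } m=m_2 ,$$ where $|\cdot|$ is the total variation. The least such $C$ is the consistency constant and $D$ is the doubling constant of the family.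 The family is $K$-uniform ($K\ge 1$) if $\mu_{m_1}(B_R(m_1))\le K\mu_{m_2}(B_R(m_2))$ for all $m_1,m_2\in M$ and $R>0$. **Theorem.** There is a numerical constant $c_0>0$ such that the following holds. (1) Let $1\le p\le\infty$, $\frac1p+\frac1q=1$, and for $1\le i\le N$ let $(M_i,d_i)$ be of pointwise homogeneous type with respect to a $K_i$-uniform family of Borel measures with doubling constant $D_i$ and consistency constant $C_i$. Let $M=\prod_{i=1}^N M_i$ with the metric $d_p(m,m')=\big(\sum_{i=1}^N d_i(m_i,m_i')^p\big)^{1/p}$ (the maximum of the $d_i(m_i,m_i')$ if $p=\infty$). Then for every $S\subset M$ and every Banach space $X$ $$\lambda(S,M;X)\le c_0(\widetilde C_p+1)(\log_2\widetilde D+1),\qquad \widetilde D=\prod_{i=1}^N D_i,\quad \widetilde C_p=\Big(\sum_{i=1}^N C_i^q\Big)^{1/q}\prod_{i=1}^N K_i ,$$ where $(\sum_i C_i^q)^{1/q}$ means $\max_i C_i$ if $q=\infty$. (2) If $(M,d)$ is of pointwise homogeneous type with respect to a family of Borel measures (not assumed uniform) with doubling constant $D$ and consistency constant $C$, then for every $S\subset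 M$ and every Banach space $X$ $$\lambda(S,M;X)\le c_0(C+1)(\log_2 D+1).$$ -/

import Mathlib

open MeasureTheory Metric
open scoped NNReal ENNReal

universe u v w

noncomputable section

/-! ### Spaces of Lipschitz functions and the extension constant -/

/-- The space of Lipschitz functions from `M` to `X`, as a subspace of all functions. -/
def lipSubmodule (𝕜 M X : Type*) [RCLike 𝕜] [MetricSpace M] [NormedAddCommGroup X]
    [NormedSpace 𝕜 X] : Submodule 𝕜 (M → X) where
  carrier := {f | ∃ K : ℝ≥0, LipschitzWith K f}
  add_mem' := by
    rintro f g ⟨K, hf⟩ ⟨L, hg⟩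
    exact ⟨K + L, hf.add hg⟩
  zero_mem' := ⟨0, LipschitzWith.const 0⟩
  smul_mem' := by
    rintro c f ⟨K, hf⟩
    refine ⟨‖c‖₊ * K, LipschitzWith.of_dist_le_mul fun x y => ?_⟩
    have h := hf.dist_le_mul x y
    rw [Pi.smul_apply, Pi.smul_apply, dist_smul₀, NNReal.coe_mul, coe_nnnorm, mul_assoc]
    exact mul_le_mul_of_nonneg_left h (norm_nonneg c)

/-- `Lip(M, X)`. It is a separate type so that its topology is the one given by the Lipschitz
seminorm and not the topology of pointwise convergence. -/
def Lip (𝕜 M X : Type*) [RCLike 𝕜] [MetricSpace M] [NormedAddCommGroup X]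
    [NormedSpace 𝕜 X] : Type _ :=
  ↥(lipSubmodule 𝕜 M X)

namespace Lip

variable {𝕜 M X : Type*} [RCLike 𝕜] [MetricSpace M] [NormedAddCommGroup X] [NormedSpace 𝕜 X]

instance : CoeFun (Lip 𝕜 M X) fun _ => M → X :=
  ⟨fun f => f.1⟩

instance : AddCommGroup (Lip 𝕜 M X) :=
  inferInstanceAs (AddCommGroup ↥(lipSubmodule 𝕜 M X))

instance : Module 𝕜 (Lip 𝕜 M X) :=
  inferInstanceAs (Module 𝕜 ↥(lipSubmodule 𝕜 M X))

/-- The Lipschitz constant `L(f) = sup_{m ≠ m'} ‖f m - f m'‖ / d(m, m')`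
(equal to `0` if `M` has at most one point). -/
def lipConst (f : Lip 𝕜 M X) : ℝ :=
  ⨆ p : {p : M × M // p.1 ≠ p.2}, ‖f p.1.1 - f p.1.2‖ / dist p.1.1 p.1.2

theorem bddAbove_quotients (f : Lip 𝕜 M X) :
    BddAbove (Set.range fun p : {p : M × M // p.1 ≠ p.2} =>
      ‖f p.1.1 - f p.1.2‖ / dist p.1.1 p.1.2) := by
  obtain ⟨K, hK⟩ := f.2
  refine ⟨K, ?_⟩
  rintro _ ⟨p, rfl⟩
  have h := hK.dist_le_mul p.1.1 p.1.2
  rw [dist_eq_norm] at h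
  exact (div_le_iff₀ (dist_pos.2 p.2)).2 h

theorem lipConst_nonneg (f : Lip 𝕜 M X) : 0 ≤ lipConst f :=
  Real.iSup_nonneg fun _ => div_nonneg (norm_nonneg _) dist_nonneg

theorem lipConst_add_le (f g : Lip 𝕜 M X) : lipConst (f + g) ≤ lipConst f + lipConst g := by
  refine Real.iSup_le (fun p => ?_) (add_nonneg (lipConst_nonneg f) (lipConst_nonneg g))
  refine le_trans ?_
    (add_le_add (le_ciSup (bddAbove_quotients f) p) (le_ciSup (bddAbove_quotients g) p))
  rw [← add_div]
  refine div_le_div_of_nonneg_right ?_ dist_nonneg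
  change ‖(f p.1.1 + g p.1.1) - (f p.1.2 + g p.1.2)‖ ≤ _
  rw [add_sub_add_comm]
  exact norm_add_le _ _

theorem lipConst_smul (c : 𝕜) (f : Lip 𝕜 M X) : lipConst (c • f) = ‖c‖ * lipConst f := by
  unfold lipConst
  rw [Real.mul_iSup_of_nonneg (norm_nonneg c)]
  congr 1
  funext p
  change ‖c • f p.1.1 - c • f p.1.2‖ / _ = _
  rw [← smul_sub, norm_smul, mul_div_assoc]

/-- `L` as a seminorm on `Lip(M, X)`. -/
def lipSeminorm (𝕜 M X : Type*) [RCLike 𝕜] [MetricSpace M] [NormedAddCommGroup X]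
    [NormedSpace 𝕜 X] : Seminorm 𝕜 (Lip 𝕜 M X) :=
  Seminorm.of lipConst lipConst_add_le lipConst_smul

instance : SeminormedAddCommGroup (Lip 𝕜 M X) :=
  (lipSeminorm 𝕜 M X).toAddGroupSeminorm.toSeminormedAddCommGroup

instance : NormedSpace 𝕜 (Lip 𝕜 M X) where
  norm_smul_le c f := (lipConst_smul c f).le

end Lip

/-- `Ext(S, M; X)`: the simultaneous Lipschitz extensions from `S` to `M`, that is, the continuous
linear operators `T : Lip(S, X) → Lip(M, X)` with `T f = f` on `S`. -/
def lipExtensions (𝕜 : Type*) {M : Type*} (X : Type*) [RCLike 𝕜] [MetricSpace M]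
    [NormedAddCommGroup X] [NormedSpace 𝕜 X] (S : Set M) :
    Set (Lip 𝕜 S X →L[𝕜] Lip 𝕜 M X) :=
  {T | ∀ (f : Lip 𝕜 S X) (s : S), T f (s : M) = f s}

/-- The extension constant `λ(S, M; X) = inf {‖T‖ : T ∈ Ext(S, M; X)}`, which is `∞` if there is no
simultaneous Lipschitz extension. -/
def extensionConst (𝕜 : Type*) {M : Type*} (X : Type*) [RCLike 𝕜] [MetricSpace M]
    [NormedAddCommGroup X] [NormedSpace 𝕜 X] (S : Set M) : ℝ≥0∞ :=
  ⨅ T ∈ lipExtensions 𝕜 X S, ENNReal.ofReal ‖T‖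

/-! ### Spaces of pointwise homogeneous type -/

section Measures

variable {M : Type*} [MetricSpace M] [MeasurableSpace M]

/-- `D_m(μ) = sup_{R > 0} μ(B_{2R}(m)) / μ(B_R(m))`. -/
def doublingConstAt (μ : Measure M) (m : M) : ℝ≥0∞ :=
  ⨆ (R : ℝ) (_ : 0 < R), μ (ball m (2 * R)) / μ (ball m R)

/-- `μ` is doubling at `m`. -/
structure IsDoublingAt (μ : Measure M) (m : M) : Prop where
  pos : ∀ R : ℝ, 0 < R → 0 < μ (ball m R)
  finite : ∀ R : ℝ, 0 < R → μ (ball m R) < ⊤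
  doubling : doublingConstAt μ m < ⊤

/-- The uniform doubling constant `D = sup_m D_m(μ_m)` of a family of measures. -/
def doublingConst (μ : M → Measure M) : ℝ≥0∞ :=
  ⨆ m, doublingConstAt (μ m) m

/-- `|μ - ν|(A)`, the total variation of `μ - ν` on `A`. Here the truncated differences `μ - ν` and
`ν - μ` of measures are the positive and the negative part in the Jordan decomposition. -/
def variationDiff (μ ν : Measure M) (A : Set M) : ℝ≥0∞ :=
  (μ - ν) A + (ν - μ) A

/-- Consistency with the metric with constant `C`: for all `m₁, m₂`, all `R > 0` and both `m = m₁`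
and `m = m₂`, `|μ_{m₁} - μ_{m₂}|(B_R(m)) ≤ C (μ_m(B_R(m)) / R) d(m₁, m₂)`. -/
def IsConsistentWith (μ : M → Measure M) (C : ℝ≥0) : Prop :=
  ∀ (m₁ m₂ m : M) (R : ℝ), m = m₁ ∨ m = m₂ → 0 < R →
    variationDiff (μ m₁) (μ m₂) (ball m R) ≤
      C * (μ m (ball m R) / ENNReal.ofReal R) * edist m₁ m₂

/-- The optimal consistency constant of a family of measures. -/
def consistencyConst (μ : M → Measure M) : ℝ≥0 :=
  sInf {C : ℝ≥0 | IsConsistentWith μ C}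

/-- `M` is of pointwise homogeneous type with respect to the family `μ`. -/
structure IsPointwiseHomogeneous (μ : M → Measure M) : Prop where
  doublingAt : ∀ m, IsDoublingAt (μ m) m
  uniform_doubling : doublingConst μ < ⊤
  consistent : ∃ C : ℝ≥0, IsConsistentWith μ C

/-- `K`-uniformity of a family of measures. -/
def IsUniformFamily (μ : M → Measure M) (K : ℝ≥0) : Prop :=
  ∀ (m₁ m₂ : M) (R : ℝ), 0 < R → μ m₁ (ball m₁ R) ≤ K * μ m₂ (ball m₂ R)

end Measures

end

/-! Off the closure of `S` the extension is an average: `T f y = ∑ a_i(y) f(s_i)`, with nonnegative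
weights of sum `1` and, where the weight is nonzero, points `s_i ∈ S` within `4 dist(y, S)` of `y`;
on the closure it is a limit of values of `f`. Such a `T` has norm at most a constant times `Λ + 1`
once the `ℓ¹`-distance of `a(y)` and `a(y')` is `O(Λ d(y, y') / dist(y, S))` for nearby points
(`extensionConst_le_of_kernels`).

The weights come from probability measures `k_y` carried by the `dist(y, S) / 4`-neighbourhood of
`y`. In `exists_weights` each `k_y` is split along a maximal family of mutually singular measures,
each of which is assigned one point of `S`. No measurable selection and no separability are needed.
If `G` dominates both `k_y` and `k_y'`, then the weights differ by at most `2 (G(Ω) - 1)` in `ℓ¹`.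

The measure `k_y` is the normalised density `decay n ∘ σ_y` with respect to the product of the
measures attached to the coordinates of `y`, where `n = log₂ D + 1` and `σ_y` is a gauge of the
distance to `y` in units of `R = dist(y, S) / 16`. Moving the gauge by `t` changes an exponential of
rate `n` by a factor `1 + O(n t)`. The error caused by the cut-off is of order `e^{-3n} ν{σ < 4}`,
and doubling gives `ν{σ < 4} ≤ D² ν{σ < 1} ≤ (e^{2n} - 1) ν{σ < 1}`, so it is absorbed by the total
mass. This is how `log D` replaces `D`.

Changing the base measure costs a factor `1 + C_i d_i / ρ` in coordinate `i` on balls of radius `ρ`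
(`exists_upper_measure`). Fibres of a ball in the product can be arbitrarily small balls, so the
gauge uses distances truncated at `ℓ_i = log₂ D_i / n`: all fibres then have radius at least `R
ℓ_i`. Since `D_i ≥ √2` unless `M_i` is a point (`two_le_sq_doublingConst`), `ℓ_i ≥ 1 / (2n)`, and
Hölder bounds the total cost by `O(n ‖C‖_q d / R)`. Since `∑ ℓ_i ≤ 1`, truncation moves the gauge by
at most `1`. -/

noncomputable section

/-! ### Masses relative to a mutually singular family -/

section MinMass

variable {Ω : Type*} [MeasurableSpace Ω]

/-- The smallest `κ`-mass of a measurable set carrying `j`, that is, the total mass of the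
part of `κ` that is absolutely continuous with respect to `j`. -/
def minMass (j κ : Measure Ω) : ℝ≥0∞ :=
  ⨅ (A : Set Ω) (_ : MeasurableSet A ∧ j Aᶜ = 0), κ A

theorem minMass_mono (j : Measure Ω) {κ κ' : Measure Ω} (h : κ ≤ κ') :
    minMass j κ ≤ minMass j κ' :=
  iInf₂_mono fun A _ => h A

theorem minMass_le {j κ : Measure Ω} {A : Set Ω} (hA : MeasurableSet A) (hj : j Aᶜ = 0) :
    minMass j κ ≤ κ A :=
  iInf₂_le A ⟨hA, hj⟩

/-- Sets carrying `j` are closed under countable intersections, so intersecting a minimising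
sequence attains the infimum. -/
theorem exists_minMass_eq (j κ : Measure Ω) :
    ∃ A, MeasurableSet A ∧ j Aᶜ = 0 ∧ κ A = minMass j κ := by
  let V : Set ℝ≥0∞ := {v | ∃ A, MeasurableSet A ∧ j Aᶜ = 0 ∧ κ A = v}
  have hV : minMass j κ = sInf V := by
    refine le_antisymm (le_sInf ?_) (le_iInf₂ fun A hA => sInf_le ⟨A, hA.1, hA.2, rfl⟩)
    rintro _ ⟨A, hA, hj, rfl⟩
    exact minMass_le hA hj
  have hne : V.Nonempty := ⟨κ Set.univ, Set.univ, MeasurableSet.univ, by simp, rfl⟩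
  obtain ⟨u, -, hu, huV⟩ := exists_seq_tendsto_sInf hne (OrderBot.bddBelow V)
  choose A hA hj hκ using huV
  refine ⟨⋂ n, A n, MeasurableSet.iInter hA, ?_, le_antisymm ?_ ?_⟩
  · rw [Set.compl_iInter]
    exact measure_iUnion_null hj
  · rw [hV]
    refine ge_of_tendsto' hu fun n => ?_
    rw [← hκ n]
    exact measure_mono (Set.iInter_subset _ n)
  · refine minMass_le (MeasurableSet.iInter hA) ?_
    rw [Set.compl_iInter]
    exact measure_iUnion_null hj

theorem mutuallySingular_of_minMass_eq_zero {j κ : Measure Ω} (h : minMass j κ = 0) :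
    κ.MutuallySingular j := by
  obtain ⟨A, hA, hj, hκ⟩ := exists_minMass_eq j κ
  exact ⟨A, hA, hκ.trans h, hj⟩

theorem sum_minMass_le (κ : Measure Ω) (J : Finset (Measure Ω))
    (hJ : (J : Set (Measure Ω)).Pairwise Measure.MutuallySingular) :
    ∑ j ∈ J, minMass j κ ≤ κ Set.univ := by
  classical
  have key : ∀ j : Measure Ω, ∀ i : Measure Ω, ∃ A, MeasurableSet A ∧ (j ∈ J → i ∈ J → j ≠ i →
      j A = 0 ∧ i Aᶜ = 0) := by
    intro j i
    by_cases h : j ∈ J ∧ i ∈ J ∧ j ≠ i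
    · obtain ⟨A, hA, h1, h2⟩ := hJ h.1 h.2.1 h.2.2
      exact ⟨A, hA, fun _ _ _ => ⟨h1, h2⟩⟩
    · exact ⟨∅, MeasurableSet.empty, fun a b c => absurd ⟨a, b, c⟩ h⟩
  choose N hN hN' using key
  -- `N j i` is null for `j` and carries `i`. Using both `(N j i)ᶜ` and `N i j` makes the carriers
  -- disjoint: `B j` avoids `N j i`, while `B i` lies inside it.
  let B : Measure Ω → Set Ω := fun j => ⋂ i ∈ J.erase j, (N j i)ᶜ ∩ N i j
  have hB : ∀ j, MeasurableSet (B j) := fun j =>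
    Finset.measurableSet_biInter _ fun i _ => (hN j i).compl.inter (hN i j)
  have hBj : ∀ j ∈ J, j (B j)ᶜ = 0 := by
    intro j hj
    simp only [B, Set.compl_iInter]
    refine (measure_biUnion_null_iff (J.erase j).countable_toSet).2 fun i hi => ?_
    have hi' := Finset.mem_erase.1 (Finset.mem_coe.1 hi)
    rw [Set.compl_inter, compl_compl]
    exact measure_union_null (hN' j i hj hi'.2 hi'.1.symm).1 (hN' i j hi'.2 hj hi'.1).2
  have hdisj : (J : Set (Measure Ω)).PairwiseDisjoint B := by
    intro j hj i hi hij
    refine Set.disjoint_left.2 fun x hx hx' => ?_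
    have h1 := Set.mem_iInter₂.1 hx i (Finset.mem_erase.2 ⟨hij.symm, hi⟩)
    have h2 := Set.mem_iInter₂.1 hx' j (Finset.mem_erase.2 ⟨hij, hj⟩)
    exact h1.1 h2.2
  calc ∑ j ∈ J, minMass j κ ≤ ∑ j ∈ J, κ (B j) :=
        Finset.sum_le_sum fun j hj => minMass_le (hB j) (hBj j hj)
    _ = κ (⋃ j ∈ J, B j) := (measure_biUnion_finset hdisj fun j _ => hB j).symm
    _ ≤ κ Set.univ := measure_mono (Set.subset_univ _)

theorem tsum_minMass_le (κ : Measure Ω) (J : Set (Measure Ω))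
    (hJ : J.Pairwise Measure.MutuallySingular) :
    ∑' j : J, minMass j.1 κ ≤ κ Set.univ := by
  classical
  rw [ENNReal.tsum_eq_iSup_sum]
  refine iSup_le fun s => ?_
  have := sum_minMass_le κ (s.map (Function.Embedding.subtype _)) (by
    intro j hj i hi hij
    simp only [Finset.coe_map, Set.mem_image] at hj hi
    obtain ⟨j, -, rfl⟩ := hj
    obtain ⟨i, -, rfl⟩ := hi
    exact hJ j.2 i.2 hij)
  simpa using this

/-- Zorn. A member of `𝒞` singular to all of a maximal `J` could be added, hence lies in `J` and is
singular to itself. -/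
theorem exists_maximal_mutuallySingular (𝒞 : Set (Measure Ω)) :
    ∃ J ⊆ 𝒞, J.Pairwise Measure.MutuallySingular ∧
      ∀ κ ∈ 𝒞, (∀ j ∈ J, κ.MutuallySingular j) → κ = 0 := by
  obtain ⟨J, hJ⟩ := zorn_subset {J : Set (Measure Ω) | J ⊆ 𝒞 ∧
      J.Pairwise Measure.MutuallySingular} (by
    intro c hc hchain
    refine ⟨⋃₀ c, ⟨Set.sUnion_subset fun s hs => (hc hs).1, ?_⟩, fun s hs =>
      Set.subset_sUnion_of_mem hs⟩
    exact (Set.pairwise_sUnion hchain.directedOn).2 fun s hs => (hc hs).2)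
  refine ⟨J, hJ.prop.1, hJ.prop.2, fun κ hκ hκJ => ?_⟩
  have hmem : κ ∈ J := by
    refine hJ.le_of_ge (y := insert κ J) ⟨Set.insert_subset hκ hJ.prop.1, ?_⟩
      (Set.subset_insert _ _) (Set.mem_insert _ _)
    exact Set.pairwise_insert.2
      ⟨hJ.prop.2, fun j hj _ => ⟨hκJ j hj, (hκJ j hj).symm⟩⟩
  exact (Measure.MutuallySingular.self_iff κ).1 (hκJ κ hmem)

/-- Only countably many `j` see any mass of `κ`. Outside the union of optimal carriers for these,
`κ` is singular to all of `J`, and the restriction still belongs to `𝒞`, so maximality makes it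
vanish. -/
theorem tsum_minMass_eq {𝒞 J : Set (Measure Ω)} (hJ : J.Pairwise Measure.MutuallySingular)
    (hmax : ∀ κ ∈ 𝒞, (∀ j ∈ J, κ.MutuallySingular j) → κ = 0)
    {κ : Measure Ω} [IsFiniteMeasure κ] (hκ : ∀ A, MeasurableSet A → κ.restrict A ∈ 𝒞) :
    ∑' j : J, minMass j.1 κ = κ Set.univ := by
  refine le_antisymm (tsum_minMass_le κ J hJ) ?_
  have hfin : ∑' j : J, minMass j.1 κ ≠ ⊤ :=
    ((tsum_minMass_le κ J hJ).trans_lt (measure_lt_top κ _)).ne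
  have hcount : (Function.support fun j : J => minMass j.1 κ).Countable :=
    Summable.countable_support_ennreal hfin
  choose A hA hj hκA using fun j : J => exists_minMass_eq j.1 κ
  set U : Set Ω := ⋃ j ∈ Function.support fun j : J => minMass j.1 κ, A j with hU
  have hUm : MeasurableSet U := MeasurableSet.biUnion hcount fun j _ => hA j
  have hzero : κ.restrict Uᶜ = 0 := by
    refine hmax _ (hκ _ hUm.compl) fun j hjJ => ?_
    by_cases h0 : minMass j κ = 0
    · exact (mutuallySingular_of_minMass_eq_zero h0).mono Measure.restrict_le_self le_rfl
    · refine ⟨U, hUm, ?_, ?_⟩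
      · rw [Measure.restrict_apply hUm]; simp
      · refine measure_mono_null (Set.compl_subset_compl.2 ?_) (hj ⟨j, hjJ⟩)
        exact Set.subset_biUnion_of_mem (u := A) (x := ⟨j, hjJ⟩) h0
  have hUc : κ Uᶜ = 0 := by
    have := congrArg (fun ν : Measure Ω => ν Set.univ) hzero
    simpa using this
  have hsupp : ∑' j : J, minMass j.1 κ
      = ∑' j : Function.support (fun j : J => minMass j.1 κ), minMass j.1.1 κ :=
    (tsum_subtype_eq_of_support_subset (f := fun j : J => minMass j.1 κ) subset_rfl).symm
  calc κ Set.univ ≤ κ U + κ Uᶜ := by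
        rw [← Set.union_compl_self U]; exact measure_union_le _ _
    _ = κ U := by rw [hUc, add_zero]
    _ ≤ ∑' j : Function.support (fun j : J => minMass j.1 κ), κ (A j.1) := by
        have := hcount.to_subtype
        rw [hU, Set.biUnion_eq_iUnion]
        exact measure_iUnion_le _
    _ = _ := by rw [hsupp]; exact tsum_congr fun j => hκA j.1

end MinMass

/-! ### Extension operators from random points of the subset -/

theorem Lip.norm_sub_le {𝕜 M X : Type*} [RCLike 𝕜] [MetricSpace M] [NormedAddCommGroup X]
    [NormedSpace 𝕜 X] (f : Lip 𝕜 M X) (x y : M) : ‖f x - f y‖ ≤ Lip.lipConst f * dist x y := by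
  rcases eq_or_ne x y with rfl | h
  · simp
  · exact (div_le_iff₀ (dist_pos.2 h)).1
      (le_ciSup (Lip.bddAbove_quotients f) (⟨(x, y), h⟩ : {p : M × M // p.1 ≠ p.2}))

theorem Lip.lipConst_le {𝕜 M X : Type*} [RCLike 𝕜] [MetricSpace M] [NormedAddCommGroup X]
    [NormedSpace 𝕜 X] (f : Lip 𝕜 M X) {c : ℝ} (hc : 0 ≤ c)
    (h : ∀ x y, ‖f x - f y‖ ≤ c * dist x y) : Lip.lipConst f ≤ c :=
  Real.iSup_le (fun p => (div_le_iff₀ (dist_pos.2 p.2)).2 (h _ _)) hc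

/-- The indices are the members `j` of a maximal mutually singular family of measures, each carried
by the neighbourhood of some centre `c j`. The weight at `y` is the mass of the part of `k y`
absolutely continuous with respect to `j`; the point `s j ∈ S` is nearly closest to `c j`. -/
theorem exists_weights {Y : Type u} {Ω : Type v} [MetricSpace Y] [MeasurableSpace Ω] {S : Set Y}
    (hS : S.Nonempty) (loc : Ω → Y) (hloc : ∀ y r, MeasurableSet {x | dist y (loc x) < r})
    (k : Y → Measure Ω) (hk1 : ∀ y ∉ closure S, k y Set.univ = 1)
    (hk2 : ∀ y ∉ closure S, k y {x | dist y (loc x) < infDist y S / 4}ᶜ = 0) :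
    ∃ (ι : Type v) (a : Y → ι → ℝ) (s : ι → S),
      (∀ y ∉ closure S, HasSum (a y) 1) ∧ (∀ y i, 0 ≤ a y i) ∧
      (∀ y ∉ closure S, ∀ i, a y i ≠ 0 → dist y (s i) ≤ 4 * infDist y S) ∧
      ∀ y ∉ closure S, ∀ y' ∉ closure S, ∀ (G : Measure Ω) (ε : ℝ), k y ≤ G → k y' ≤ G → 0 ≤ ε →
        G Set.univ ≤ ENNReal.ofReal (1 + ε) →
        Summable (fun i => |a y i - a y' i|) ∧ ∑' i, |a y i - a y' i| ≤ 2 * ε := by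
  let U : Y → Set Ω := fun y => {x | dist y (loc x) < infDist y S / 4}
  have hU : ∀ y, MeasurableSet (U y) := fun y => hloc _ _
  let 𝒞 : Set (Measure Ω) := {κ | ∃ y ∉ closure S, κ (U y)ᶜ = 0}
  obtain ⟨J, hJ𝒞, hJ, hmax⟩ := exists_maximal_mutuallySingular 𝒞
  have hpos : ∀ y ∉ closure S, 0 < infDist y S := fun y hy => by
    rw [← infDist_closure]
    exact (isClosed_closure.notMem_iff_infDist_pos hS.closure).1 hy
  choose c hc hcU using fun j : J => hJ𝒞 j.2
  have hs : ∀ j : J, ∃ s : S, dist (c j) s < 2 * infDist (c j) S := fun j => by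
    obtain ⟨s, hs, h⟩ := (infDist_lt_iff hS).1
      (show infDist (c j) S < 2 * infDist (c j) S by linarith [hpos _ (hc j)])
    exact ⟨⟨s, hs⟩, h⟩
  choose s hs using hs
  have hle : ∀ y ∉ closure S, ∀ j : J, minMass j.1 (k y) ≤ 1 := fun y hy j =>
    (minMass_le MeasurableSet.univ (by simp)).trans (hk1 y hy).le
  have hsum : ∀ y ∉ closure S, ∑' j : J, minMass j.1 (k y) = 1 := by
    intro y hy
    have : IsFiniteMeasure (k y) := ⟨by rw [hk1 y hy]; exact ENNReal.one_lt_top⟩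
    rw [tsum_minMass_eq hJ hmax fun A hA => ⟨y, hy, ?_⟩, hk1 y hy]
    exact le_antisymm ((Measure.restrict_le_self _).trans (hk2 y hy).le) zero_le
  have hhs : ∀ κ : Measure Ω, κ Set.univ ≠ ⊤ →
      Summable (fun j : J => (minMass j.1 κ).toReal) ∧
      ∑' j : J, (minMass j.1 κ).toReal ≤ (κ Set.univ).toReal := by
    intro κ hκ
    have hne : ∑' j : J, minMass j.1 κ ≠ ⊤ := ne_top_of_le_ne_top hκ (tsum_minMass_le κ J hJ)
    refine ⟨ENNReal.summable_toReal hne, ?_⟩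
    rw [← ENNReal.tsum_toReal_eq fun j => ENNReal.ne_top_of_tsum_ne_top hne j]
    exact ENNReal.toReal_mono hκ (tsum_minMass_le κ J hJ)
  have hhas : ∀ y ∉ closure S, HasSum (fun j : J => (minMass j.1 (k y)).toReal) 1 := by
    intro y hy
    have h1 := (hhs (k y) (by simp [hk1 y hy])).1.hasSum
    rwa [← ENNReal.tsum_toReal_eq fun j => ((hle y hy j).trans_lt ENNReal.one_lt_top).ne,
      hsum y hy, ENNReal.toReal_one] at h1
  refine ⟨J, fun y j => (minMass j.1 (k y)).toReal, s, hhas, fun _ _ => ENNReal.toReal_nonneg,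
    ?_, ?_⟩
  · intro y hy j hj
    have hne : minMass j.1 (k y) ≠ 0 := fun h => hj (by simp [h])
    have hint : (U y ∩ U (c j)).Nonempty := by
      by_contra hempty
      rw [Set.not_nonempty_iff_eq_empty] at hempty
      refine hne (le_antisymm ((minMass_le (hU (c j)) (hcU j)).trans ?_) zero_le)
      refine (measure_mono ?_).trans (hk2 y hy).le
      exact fun x hx hx' => (hempty ▸ (⟨hx', hx⟩ : x ∈ U y ∩ U (c j)) : x ∈ (∅ : Set Ω))
    obtain ⟨x, hx, hx'⟩ := hint
    -- With `r = infDist y S`, overlap of the neighbourhoods forces `infDist (c j) S ≤ 5r/3`. Hence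
    -- `dist y (s j) ≤ r/4 + 5r/12 + 10r/3 = 4r`.
    have h1 : dist y (c j) < infDist y S / 4 + infDist (c j) S / 4 := by
      have h2 : dist (c j) (loc x) < infDist (c j) S / 4 := hx'
      have h3 : dist y (loc x) < infDist y S / 4 := hx
      linarith [dist_triangle_right y (c j) (loc x)]
    have h2 : infDist (c j) S ≤ infDist y S + dist (c j) y := infDist_le_infDist_add_dist
    rw [dist_comm] at h2
    linarith [dist_triangle y (c j) (s j), hs j]
  · intro y hy y' hy' G ε hG hG' hε hGε
    have hGtop : G Set.univ ≠ ⊤ := ne_top_of_le_ne_top ENNReal.ofReal_ne_top hGε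
    have hg := hhs G hGtop
    have hgle : (G Set.univ).toReal ≤ 1 + ε := ENNReal.toReal_le_of_le_ofReal (by linarith) hGε
    have hjt : ∀ j : J, minMass j.1 G ≠ ⊤ := fun j =>
      ne_top_of_le_ne_top hGtop (minMass_le MeasurableSet.univ (by simp))
    have h1 : ∀ j : J, (minMass j.1 (k y)).toReal ≤ (minMass j.1 G).toReal := fun j =>
      ENNReal.toReal_mono (hjt j) (minMass_mono _ hG)
    have h2 : ∀ j : J, (minMass j.1 (k y')).toReal ≤ (minMass j.1 G).toReal := fun j =>
      ENNReal.toReal_mono (hjt j) (minMass_mono _ hG')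
    -- Both weights lie below the mass of `G`, so the two gaps dominate the difference; each family
    -- of gaps sums to at most `ε`.
    have hb : ∀ j : J, |(minMass j.1 (k y)).toReal - (minMass j.1 (k y')).toReal| ≤
        ((minMass j.1 G).toReal - (minMass j.1 (k y)).toReal) +
        ((minMass j.1 G).toReal - (minMass j.1 (k y')).toReal) := fun j => by
      rw [abs_le]; constructor <;> linarith [h1 j, h2 j]
    have hB := (hg.1.hasSum.sub (hhas y hy)).add (hg.1.hasSum.sub (hhas y' hy'))
    have hS' := Summable.of_nonneg_of_le (fun j => abs_nonneg _) hb hB.summable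
    refine ⟨hS', (hS'.tsum_le_tsum hb hB.summable).trans ?_⟩
    rw [hB.tsum_eq]
    linarith [hg.2]

/-- Pointwise functionals with suitable estimates assemble to an extension operator. -/
theorem extensionConst_le_of_functionals {𝕜 Y X : Type*} [RCLike 𝕜] [MetricSpace Y]
    [NormedAddCommGroup X] [NormedSpace 𝕜 X] {S : Set Y} (hS : S.Nonempty) {Λ : ℝ} (hΛ : 0 ≤ Λ)
    (E : Y → Lip 𝕜 S X →ₗ[𝕜] X)
    (hE : ∀ (y : Y) (f : Lip 𝕜 S X) (s : S),
      ‖E y f - f s‖ ≤ Lip.lipConst f * (4 * infDist y S + dist y s))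
    (hnear : ∀ y ∉ closure S, ∀ y' ∉ closure S, dist y y' ≤ infDist y S / 4 →
      ∀ f : Lip 𝕜 S X, ‖E y f - E y' f‖ ≤ Lip.lipConst f * (Λ * dist y y')) :
    extensionConst 𝕜 X S ≤ ENNReal.ofReal (43 + Λ) := by
  have hmain : ∀ (f : Lip 𝕜 S X) (y y' : Y), infDist y' S ≤ infDist y S →
      ‖E y f - E y' f‖ ≤ (43 + Λ) * Lip.lipConst f * dist y y' := by
    intro f y y' hyy'
    have hL := Lip.lipConst_nonneg f
    have hd : 0 ≤ dist y y' := dist_nonneg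
    by_cases h : dist y y' < infDist y S / 4
    · have hr : infDist y S ≤ infDist y' S + dist y y' := infDist_le_infDist_add_dist
      have hcl : ∀ z : Y, 0 < infDist z S → z ∉ closure S := fun z hz hz' => by
        rw [mem_closure_iff_infDist_zero hS] at hz'
        exact hz.ne' hz'
      refine (hnear y (hcl y (by linarith)) y' (hcl y' (by linarith)) h.le f).trans ?_
      nlinarith [mul_nonneg hL hd]
    · push Not at h
      rcases hd.eq_or_lt with h0 | h0
      · rw [← h0, dist_eq_zero.1 h0.symm]; simp
      obtain ⟨s, hs, hys⟩ := (infDist_lt_iff hS).1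
        (show infDist y S < infDist y S + dist y y' by linarith)
      have h1 := hE y f ⟨s, hs⟩
      have h2 := hE y' f ⟨s, hs⟩
      have h3 : dist y' s ≤ dist y y' + dist y s := dist_triangle_left _ _ _
      have h4 : ‖E y f - E y' f‖ ≤ ‖E y f - f ⟨s, hs⟩‖ + ‖E y' f - f ⟨s, hs⟩‖ := by
        rw [← norm_neg (E y' f - f ⟨s, hs⟩), neg_sub]
        exact norm_sub_le_norm_sub_add_norm_sub _ _ _
      -- Here `infDist y' S ≤ infDist y S ≤ 4d`, `dist y s ≤ 5d` and `dist y' s ≤ 6d` with `d = dist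
      -- y y'`, so the total is `16 + 5 + 16 + 6 = 43`.
      have h5 : Lip.lipConst f * (4 * infDist y S + dist y s) +
          Lip.lipConst f * (4 * infDist y' S + dist y' s) ≤ Lip.lipConst f * (43 * dist y y') := by
        rw [← mul_add]
        exact mul_le_mul_of_nonneg_left (by linarith) hL
      calc ‖E y f - E y' f‖ ≤ Lip.lipConst f * (43 * dist y y') := by
            simp only at h1 h2; linarith
        _ ≤ _ := by nlinarith [mul_nonneg (mul_nonneg hL hd) hΛ]
  have hmain' : ∀ (f : Lip 𝕜 S X) (y y' : Y),
      ‖E y f - E y' f‖ ≤ (43 + Λ) * Lip.lipConst f * dist y y' := by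
    intro f y y'
    rcases le_total (infDist y' S) (infDist y S) with h | h
    · exact hmain f y y' h
    · rw [norm_sub_rev, dist_comm]; exact hmain f y' y h
  have hc : ∀ f : Lip 𝕜 S X, 0 ≤ (43 + Λ) * Lip.lipConst f := fun f =>
    mul_nonneg (by linarith) (Lip.lipConst_nonneg f)
  let T₀ : Lip 𝕜 S X →ₗ[𝕜] Lip 𝕜 Y X :=
    { toFun := fun f => ⟨fun y => E y f, ⟨⟨_, hc f⟩, LipschitzWith.of_dist_le_mul fun y y' => by
        rw [dist_eq_norm]; exact hmain' f y y'⟩⟩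
      map_add' := fun f g => Subtype.ext (funext fun y => map_add (E y) f g)
      map_smul' := fun c f => Subtype.ext (funext fun y => map_smul (E y) c f) }
  have hT₀ : ∀ f, ‖T₀ f‖ ≤ (43 + Λ) * ‖f‖ := fun f =>
    Lip.lipConst_le (T₀ f) (hc f) fun y y' => hmain' f y y'
  let T := T₀.mkContinuous (43 + Λ) hT₀
  have hT : T ∈ lipExtensions 𝕜 X S := by
    intro f s
    have h := hE s f s
    rw [infDist_zero_of_mem s.2, dist_self] at h
    simp only [mul_zero, add_zero, norm_le_zero_iff, sub_eq_zero] at h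
    exact h
  exact (iInf₂_le T hT).trans
    (ENNReal.ofReal_le_ofReal (T₀.mkContinuous_norm_le (by linarith) hT₀))

/-- At the closure of `S` the values of an extension are limits. -/
theorem exists_closure_functional {𝕜 Y X : Type*} [RCLike 𝕜] [MetricSpace Y]
    [NormedAddCommGroup X] [NormedSpace 𝕜 X] [CompleteSpace X] {S : Set Y} {y : Y}
    (hy : y ∈ closure S) :
    ∃ E : Lip 𝕜 S X →ₗ[𝕜] X, ∀ (f : Lip 𝕜 S X) (s : S),
      ‖E f - f s‖ ≤ Lip.lipConst f * (4 * infDist y S + dist y s) := by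
  obtain ⟨x, hx, hxy⟩ := mem_closure_iff_seq_limit.1 hy
  have hlim : ∀ f : Lip 𝕜 S X, ∃ z, Filter.Tendsto (fun n => f ⟨x n, hx n⟩) Filter.atTop (nhds z) := by
    intro f
    obtain ⟨K, hK⟩ := f.2
    refine cauchySeq_tendsto_of_complete ?_
    have h1 : CauchySeq fun n => (⟨x n, hx n⟩ : S) :=
      isUniformEmbedding_subtype_val.isUniformInducing.cauchy_map_iff.1
        (by rw [Filter.map_map]; exact hxy.cauchySeq)
    exact h1.map hK.uniformContinuous
  choose e he using hlim
  refine ⟨⟨⟨e, fun f g => tendsto_nhds_unique (he (f + g)) ((he f).add (he g))⟩,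
    fun c f => tendsto_nhds_unique (he (c • f)) ((he f).const_smul c)⟩, fun f s => ?_⟩
  have h1 : Filter.Tendsto (fun n => ‖f ⟨x n, hx n⟩ - f s‖) Filter.atTop (nhds ‖e f - f s‖) :=
    ((he f).sub_const _).norm
  have h2 : Filter.Tendsto (fun n => Lip.lipConst f * dist (x n) s) Filter.atTop
      (nhds (Lip.lipConst f * dist y s)) := (hxy.dist tendsto_const_nhds).const_mul _
  refine (le_of_tendsto_of_tendsto' h1 h2 fun n => Lip.norm_sub_le f _ _).trans ?_
  exact mul_le_mul_of_nonneg_left (by linarith [infDist_nonneg (x := y) (s := S)])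
    (Lip.lipConst_nonneg f)

/-- Probability measures `k y`, concentrated near `y` and varying slowly with `y`, yield an
extension operator. -/
theorem extensionConst_le_of_kernels {𝕜 Y X Ω : Type*} [RCLike 𝕜] [MetricSpace Y]
    [NormedAddCommGroup X] [NormedSpace 𝕜 X] [CompleteSpace X] [MeasurableSpace Ω] {S : Set Y}
    (hS : S.Nonempty) (loc : Ω → Y) (hloc : ∀ y r, MeasurableSet {x | dist y (loc x) < r})
    (k : Y → Measure Ω) (hk1 : ∀ y ∉ closure S, k y Set.univ = 1)
    (hk2 : ∀ y ∉ closure S, k y {x | dist y (loc x) < infDist y S / 4}ᶜ = 0)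
    {Λ : ℝ} (hΛ : 0 ≤ Λ)
    (hk3 : ∀ y ∉ closure S, ∀ y' ∉ closure S, dist y y' ≤ infDist y S / 4 →
      ∃ G : Measure Ω, k y ≤ G ∧ k y' ≤ G ∧
        G Set.univ ≤ ENNReal.ofReal (1 + Λ * dist y y' / infDist y S)) :
    extensionConst 𝕜 X S ≤ ENNReal.ofReal (43 + 16 * Λ) := by
  obtain ⟨ι, a, s, hsum, ha, hdist, hdiff⟩ := exists_weights hS loc hloc k hk1 hk2
  have hpos : ∀ y ∉ closure S, 0 < infDist y S := fun y hy => by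
    rw [← infDist_closure]
    exact (isClosed_closure.notMem_iff_infDist_pos hS.closure).1 hy
  have hterm : ∀ y ∉ closure S, ∀ (f : Lip 𝕜 S X) (s₀ : S) (i : ι),
      ‖((a y i : ℝ) : 𝕜) • (f (s i) - f s₀)‖ ≤
        a y i * (Lip.lipConst f * (4 * infDist y S + dist y s₀)) := by
    intro y hy f s₀ i
    rw [norm_smul, RCLike.norm_ofReal, abs_of_nonneg (ha y i)]
    rcases eq_or_ne (a y i) 0 with h0 | h0
    · simp [h0]
    · refine mul_le_mul_of_nonneg_left ((Lip.norm_sub_le f _ _).trans ?_) (ha y i)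
      refine mul_le_mul_of_nonneg_left ?_ (Lip.lipConst_nonneg f)
      have := hdist y hy i h0
      have h2 : dist (s i) s₀ ≤ dist y (s i) + dist y s₀ := dist_triangle_left (s i : Y) s₀ y
      linarith
  have hsub : ∀ y ∉ closure S, ∀ (f : Lip 𝕜 S X) (s₀ : S),
      Summable fun i => ((a y i : ℝ) : 𝕜) • (f (s i) - f s₀) := fun y hy f s₀ =>
    Summable.of_norm_bounded ((hsum y hy).summable.mul_right _) (hterm y hy f s₀)
  have hone : ∀ y ∉ closure S, HasSum (fun i => ((a y i : ℝ) : 𝕜)) 1 := fun y hy => by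
    have h := (RCLike.hasSum_ofReal (𝕜 := 𝕜)).2 (hsum y hy)
    rwa [RCLike.ofReal_one] at h
  have hmul : ∀ y ∉ closure S, ∀ f : Lip 𝕜 S X,
      Summable fun i => ((a y i : ℝ) : 𝕜) • f (s i) := fun y hy f => by
    obtain ⟨t, ht⟩ := hS
    have := (hsub y hy f ⟨t, ht⟩).add ((hone y hy).summable.smul_const (f ⟨t, ht⟩))
    refine this.congr fun i => ?_
    rw [smul_sub, sub_add_cancel]
  have hval : ∀ y ∉ closure S, ∀ (f : Lip 𝕜 S X) (s₀ : S),
      ∑' i, ((a y i : ℝ) : 𝕜) • (f (s i) - f s₀) = (∑' i, ((a y i : ℝ) : 𝕜) • f (s i)) - f s₀ := by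
    intro y hy f s₀
    have h1 := (hmul y hy f).hasSum.sub ((hone y hy).smul_const (f s₀))
    rw [one_smul] at h1
    rw [← h1.tsum_eq]
    exact tsum_congr fun i => smul_sub _ _ _
  have hE : ∀ y : Y, ∃ E : Lip 𝕜 S X →ₗ[𝕜] X,
      (∀ (f : Lip 𝕜 S X) (s₀ : S),
        ‖E f - f s₀‖ ≤ Lip.lipConst f * (4 * infDist y S + dist y s₀)) ∧
      (y ∉ closure S → ∀ f, E f = ∑' i, ((a y i : ℝ) : 𝕜) • f (s i)) := by
    intro y
    by_cases hy : y ∈ closure S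
    · obtain ⟨E, hE⟩ := exists_closure_functional (𝕜 := 𝕜) (X := X) hy
      exact ⟨E, hE, fun h => absurd hy h⟩
    · refine ⟨⟨⟨fun f => ∑' i, ((a y i : ℝ) : 𝕜) • f (s i), fun f g => ?_⟩, fun c f => ?_⟩,
        fun f s₀ => ?_, fun _ f => rfl⟩
      · rw [← (hmul y hy f).tsum_add (hmul y hy g)]
        exact tsum_congr fun i => smul_add _ _ _
      · rw [RingHom.id_apply, ← (hmul y hy f).tsum_const_smul]
        exact tsum_congr fun i => smul_comm _ _ _
      · change ‖(∑' i, ((a y i : ℝ) : 𝕜) • f (s i)) - f s₀‖ ≤ _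
        rw [← hval y hy f s₀]
        have := tsum_of_norm_bounded ((hsum y hy).mul_right
          (Lip.lipConst f * (4 * infDist y S + dist y s₀))) (hterm y hy f s₀)
        rwa [one_mul] at this
  choose E hE1 hE2 using hE
  refine extensionConst_le_of_functionals hS (by positivity) E hE1 ?_
  intro y hy y' hy' hyy' f
  obtain ⟨G, hG, hG', hGu⟩ := hk3 y hy y' hy' hyy'
  have hr := hpos y hy
  have hd : 0 ≤ dist y y' := dist_nonneg
  obtain ⟨hsm, hle⟩ := hdiff y hy y' hy' G _ hG hG' (by positivity) hGu
  obtain ⟨t, ht, hyt⟩ := (infDist_lt_iff hS).1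
    (show infDist y S < 2 * infDist y S by linarith)
  have hr' : infDist y' S ≤ infDist y S + dist y' y := infDist_le_infDist_add_dist
  rw [dist_comm] at hr'
  rw [hE2 y hy, hE2 y' hy']
  have h1 : (∑' i, ((a y i : ℝ) : 𝕜) • f (s i)) - ∑' i, ((a y' i : ℝ) : 𝕜) • f (s i) =
      ∑' i, ((a y i - a y' i : ℝ) : 𝕜) • (f (s i) - f ⟨t, ht⟩) := by
    have h2 := (hsub y hy f ⟨t, ht⟩).hasSum.sub (hsub y' hy' f ⟨t, ht⟩).hasSum
    rw [hval y hy, hval y' hy', sub_sub_sub_cancel_right] at h2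
    rw [← h2.tsum_eq]
    exact tsum_congr fun i => by rw [← sub_smul, RCLike.ofReal_sub]
  rw [h1]
  -- The differences of weights sum to `0`, so a reference value `f t` may be subtracted. Every `s
  -- i` in play is within `6r` of `y`, and `t` within `2r`, where `r = infDist y S`.
  have hb : ∀ i, ‖((a y i - a y' i : ℝ) : 𝕜) • (f (s i) - f ⟨t, ht⟩)‖ ≤
      |a y i - a y' i| * (Lip.lipConst f * (8 * infDist y S)) := by
    intro i
    rw [norm_smul, RCLike.norm_ofReal]
    by_cases h0 : a y i = 0 ∧ a y' i = 0
    · simp [h0.1, h0.2]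
    refine mul_le_mul_of_nonneg_left ((Lip.norm_sub_le f _ _).trans ?_) (abs_nonneg _)
    refine mul_le_mul_of_nonneg_left ?_ (Lip.lipConst_nonneg f)
    have h3 : dist (s i) ⟨t, ht⟩ ≤ dist y (s i) + dist y t := dist_triangle_left (s i : Y) t y
    have h4 : dist y (s i) ≤ 6 * infDist y S := by
      by_cases h5 : a y i = 0
      · have h6 := hdist y' hy' i fun h => h0 ⟨h5, h⟩
        linarith [dist_triangle y y' (s i)]
      · linarith [hdist y hy i h5]
    linarith
  refine (tsum_of_norm_bounded (hsm.hasSum.mul_right _) hb).trans ?_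
  have hL := Lip.lipConst_nonneg f
  calc (∑' i, |a y i - a y' i|) * (Lip.lipConst f * (8 * infDist y S))
      ≤ (2 * (Λ * dist y y' / infDist y S)) * (Lip.lipConst f * (8 * infDist y S)) :=
        mul_le_mul_of_nonneg_right hle (by positivity)
    _ = Lip.lipConst f * (16 * Λ * dist y y') := by field_simp; ring

/-! ### Slowly varying kernels -/

/-- A weight that is constant up to `1`, decays exponentially with rate `b` and vanishes from `3` on. -/
def decay (b t : ℝ) : ℝ :=
  Real.exp (-(b * max 1 (min t 3))) - Real.exp (-(b * 3))

theorem decay_antitone {b : ℝ} (hb : 0 ≤ b) : Antitone (decay b) := by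
  intro s t hst
  unfold decay
  gcongr

theorem continuous_decay (b : ℝ) : Continuous (decay b) := by
  unfold decay
  fun_prop

theorem decay_of_three_le (b : ℝ) {t : ℝ} (ht : 3 ≤ t) : decay b t = 0 := by
  unfold decay
  rw [min_eq_right ht, max_eq_right (by norm_num), sub_self]

theorem decay_of_le_one (b : ℝ) {t : ℝ} (ht : t ≤ 1) : decay b t = decay b 1 := by
  unfold decay
  rw [min_eq_left (by linarith : t ≤ 3), max_eq_left ht, min_eq_left (by norm_num : (1 : ℝ) ≤ 3),
    max_self]

theorem decay_nonneg {b : ℝ} (hb : 0 ≤ b) (t : ℝ) : 0 ≤ decay b t := by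
  rcases le_total t 3 with h | h
  · rw [← decay_of_three_le b le_rfl]; exact decay_antitone hb h
  · rw [decay_of_three_le b h]

theorem decay_one (b : ℝ) : decay b 1 = Real.exp (-(b * 3)) * (Real.exp (2 * b) - 1) := by
  unfold decay
  rw [min_eq_left (by norm_num : (1 : ℝ) ≤ 3), max_self, mul_sub, ← Real.exp_add]
  ring_nf

theorem decay_le_one {b : ℝ} (hb : 0 ≤ b) (t : ℝ) : decay b t ≤ 1 := by
  unfold decay
  have h1 : Real.exp (-(b * max 1 (min t 3))) ≤ 1 := by
    rw [Real.exp_le_one_iff]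
    have : (0 : ℝ) ≤ max 1 (min t 3) := le_max_of_le_left zero_le_one
    nlinarith [mul_nonneg hb this]
  linarith [Real.exp_pos (-(b * 3))]

/-- Adding back the cut-off constant `e^{-3b}` turns `decay` into a genuine exponential of a
`1`-Lipschitz function, which a shift by `h` multiplies by at most `e^{bh}`. -/
theorem decay_sub_le {b h : ℝ} (hb : 0 ≤ b) (hh : 0 ≤ h) (t : ℝ) :
    decay b (t - h) ≤
      decay b t + (Real.exp (b * h) - 1) * (decay b t + Real.exp (-(b * 3))) := by
  unfold decay
  have h1 : max 1 (min t 3) - h ≤ max 1 (min (t - h) 3) := by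
    rw [sub_le_iff_le_add]
    refine max_le (by linarith [le_max_left 1 (min (t - h) 3)]) ?_
    rw [← sub_le_iff_le_add]
    refine le_max_of_le_right (le_min ?_ ?_)
    · linarith [min_le_left t 3]
    · linarith [min_le_right t 3]
  have h2 : Real.exp (-(b * max 1 (min (t - h) 3))) ≤
      Real.exp (b * h) * Real.exp (-(b * max 1 (min t 3))) := by
    rw [← Real.exp_add, Real.exp_le_exp]
    nlinarith
  linarith

section

variable {Ω : Type*} [MeasurableSpace Ω]

/-- Comparison of two measures on sublevel sets passes to decreasing functions. -/
theorem lintegral_antitone_le {H ν : Measure Ω} {σ : Ω → ℝ} (hσ : Measurable σ) {g : ℝ → ℝ}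
    (hg : Antitone g) (hgc : Continuous g) (hg0 : ∀ t, 0 ≤ g t) (hg1 : ∀ t ≤ 1, g t = g 1)
    (hg4 : ∀ t, 4 ≤ t → g t = 0) {c : ℝ≥0∞} (hc : c ≠ ⊤)
    (h : ∀ s, 1 ≤ s → s ≤ 4 → H {x | σ x < s} ≤ c * ν {x | σ x < s}) :
    ∫⁻ x, ENNReal.ofReal (g (σ x)) ∂H ≤ c * ∫⁻ x, ENNReal.ofReal (g (σ x)) ∂ν := by
  have hm : Measurable fun x => g (σ x) := hgc.measurable.comp hσ
  rw [lintegral_eq_lintegral_meas_lt H (.of_forall fun x => hg0 _) hm.aemeasurable,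
    lintegral_eq_lintegral_meas_lt ν (.of_forall fun x => hg0 _) hm.aemeasurable,
    ← lintegral_const_mul' c _ hc]
  refine setLIntegral_mono' measurableSet_Ioi fun t ht => ?_
  have ht0 : 0 < t := ht
  by_cases h1 : t < g 1
  · let W : Set ℝ := {r | g r ≤ t}
    have hWc : IsClosed W := isClosed_le hgc continuous_const
    have h4 : (4 : ℝ) ∈ W := by
      change g 4 ≤ t
      rw [hg4 4 le_rfl]; exact ht0.le
    have hWb : ∀ r ∈ W, 1 ≤ r := by
      intro r hr
      by_contra hlt
      have : g r ≤ t := hr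
      rw [hg1 r (not_le.1 hlt).le] at this
      linarith
    have hbdd : BddBelow W := ⟨1, hWb⟩
    have hs := hWc.csInf_mem ⟨4, h4⟩ hbdd
    -- By the layer-cake formula only superlevel sets of `g ∘ σ` matter; these are sublevel sets of
    -- `σ` with threshold in `[1, 4]`.
    have hset : {x | t < g (σ x)} = {x | σ x < sInf W} := by
      ext x
      simp only [Set.mem_ofPred_eq]
      constructor
      · intro hx
        by_contra hlt
        have h5 : g (sInf W) ≤ t := hs
        linarith [hg (not_lt.1 hlt)]
      · intro hx
        by_contra hlt
        exact absurd (csInf_le hbdd (show σ x ∈ W from not_lt.1 hlt)) (not_le.2 hx)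
    rw [hset]
    exact h _ (hWb _ hs) (csInf_le hbdd h4)
  · have hset : {x | t < g (σ x)} = ∅ := by
      ext x
      simp only [Set.mem_ofPred_eq, Set.mem_empty_iff_false, iff_false, not_lt]
      refine le_trans ?_ (not_lt.1 h1)
      rcases le_total (σ x) 1 with h2 | h2
      · exact (hg1 _ h2).le
      · exact hg h2
    rw [hset]
    simp

/-- The measure `ν` with density `decay b ∘ σ`. -/
def decayMeasure (b : ℝ) (ν : Measure Ω) (σ : Ω → ℝ) : Measure Ω :=
  ν.withDensity fun x => ENNReal.ofReal (decay b (σ x))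

/-- The normalisation of `decayMeasure`. -/
def decayKernel (b : ℝ) (ν : Measure Ω) (σ : Ω → ℝ) : Measure Ω :=
  (decayMeasure b ν σ Set.univ)⁻¹ • decayMeasure b ν σ

/-- The sublevel sets `{σ < 1}` and `{σ < 4}` have comparable finite and positive measures. -/
structure HasGrowth (b : ℝ) (ν : Measure Ω) (σ : Ω → ℝ) : Prop where
  measurable : Measurable σ
  pos : 0 < ν {x | σ x < 1}
  finite : ν {x | σ x < 4} < ⊤
  growth : ν {x | σ x < 4} ≤ ENNReal.ofReal (Real.exp (2 * b) - 1) * ν {x | σ x < 1}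

theorem decayMeasure_univ (b : ℝ) (ν : Measure Ω) (σ : Ω → ℝ) :
    decayMeasure b ν σ Set.univ = ∫⁻ x, ENNReal.ofReal (decay b (σ x)) ∂ν := by
  rw [decayMeasure, withDensity_apply _ MeasurableSet.univ, Measure.restrict_univ]

theorem HasGrowth.measurableSet_lt {b : ℝ} {ν : Measure Ω} {σ : Ω → ℝ} (h : HasGrowth b ν σ)
    (s : ℝ) : MeasurableSet {x | σ x < s} :=
  _root_.measurableSet_lt h.measurable measurable_const

theorem HasGrowth.measurable_decay {b : ℝ} {ν : Measure Ω} {σ : Ω → ℝ} (h : HasGrowth b ν σ)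
    (t : ℝ) : Measurable fun x => ENNReal.ofReal (decay b (σ x - t)) :=
  ((continuous_decay b).measurable.comp (h.measurable.sub_const t)).ennreal_ofReal

theorem HasGrowth.mul_le_decayMeasure {b : ℝ} {ν : Measure Ω} {σ : Ω → ℝ}
    (h : HasGrowth b ν σ) :
    ENNReal.ofReal (decay b 1) * ν {x | σ x < 1} ≤ decayMeasure b ν σ Set.univ := by
  rw [decayMeasure_univ, ← setLIntegral_const]
  refine (setLIntegral_mono' (h.measurableSet_lt 1) fun x hx => ?_).trans
    (setLIntegral_le_lintegral _ _)
  rw [decay_of_le_one b (le_of_lt hx)]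

/-- The factor `e^{2b} - 1` in the growth condition is exactly `decay b 1 / e^{-3b}`, so the plateau
`{σ < 1}` alone pays for the cut-off error on `{σ < 4}`. -/
theorem HasGrowth.exp_mul_le {b : ℝ} {ν : Measure Ω} {σ : Ω → ℝ} (h : HasGrowth b ν σ) :
    ENNReal.ofReal (Real.exp (-(b * 3))) * ν {x | σ x < 4} ≤ decayMeasure b ν σ Set.univ := by
  refine le_trans ?_ h.mul_le_decayMeasure
  rw [decay_one, ENNReal.ofReal_mul (Real.exp_pos _).le, mul_assoc]
  exact mul_le_mul_right h.growth _

theorem HasGrowth.decayMeasure_pos {b : ℝ} (hb : 0 < b) {ν : Measure Ω} {σ : Ω → ℝ}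
    (h : HasGrowth b ν σ) : decayMeasure b ν σ Set.univ ≠ 0 := by
  refine (lt_of_lt_of_le (ENNReal.mul_pos ?_ h.pos.ne') h.mul_le_decayMeasure).ne'
  rw [decay_one, Ne, ENNReal.ofReal_eq_zero, not_le]
  have : 1 < Real.exp (2 * b) := Real.one_lt_exp_iff.2 (by linarith)
  exact mul_pos (Real.exp_pos _) (by linarith)

theorem HasGrowth.decayMeasure_ne_top {b : ℝ} (hb : 0 ≤ b) {ν : Measure Ω} {σ : Ω → ℝ}
    (h : HasGrowth b ν σ) : decayMeasure b ν σ Set.univ ≠ ⊤ := by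
  refine ((?_ : _ ≤ ν {x | σ x < 4}).trans_lt h.finite).ne
  rw [decayMeasure_univ, ← lintegral_indicator_one (h.measurableSet_lt 4)]
  refine lintegral_mono fun x => ?_
  by_cases hx : σ x < 4
  · rw [Set.indicator_of_mem (by exact hx)]
    exact ENNReal.ofReal_le_one.2 (decay_le_one hb _)
  · rw [decay_of_three_le b (by linarith)]
    simp

theorem HasGrowth.decayKernel_univ {b : ℝ} (hb : 0 < b) {ν : Measure Ω} {σ : Ω → ℝ}
    (h : HasGrowth b ν σ) : decayKernel b ν σ Set.univ = 1 := by
  rw [decayKernel, Measure.smul_apply, smul_eq_mul]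
  exact ENNReal.inv_mul_cancel (h.decayMeasure_pos hb) (h.decayMeasure_ne_top hb.le)

theorem HasGrowth.decayKernel_eq_zero {b : ℝ} {ν : Measure Ω} {σ : Ω → ℝ}
    (h : HasGrowth b ν σ) : decayKernel b ν σ {x | 3 ≤ σ x} = 0 := by
  have hm : MeasurableSet {x | 3 ≤ σ x} := measurableSet_le measurable_const h.measurable
  rw [decayKernel, Measure.smul_apply, decayMeasure, withDensity_apply _ hm,
    setLIntegral_congr_fun hm (g := fun _ => 0) fun x hx => by
      simp [decay_of_three_le b hx]]
  simp

/-- Integrate `decay_sub_le`. As `t ≤ 1`, the shifted density lives on `{σ < 4}`. The `2` counts the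
density itself and the cut-off error, each at most the total mass. -/
theorem HasGrowth.lintegral_shift_le {b t : ℝ} (hb : 0 ≤ b) (ht : 0 ≤ t) (ht1 : t ≤ 1)
    {ν : Measure Ω} {σ : Ω → ℝ} (h : HasGrowth b ν σ) :
    ∫⁻ x, ENNReal.ofReal (decay b (σ x - t)) ∂ν ≤
      ENNReal.ofReal (1 + 2 * (Real.exp (b * t) - 1)) * decayMeasure b ν σ Set.univ := by
  have he : 0 ≤ Real.exp (b * t) - 1 := by
    linarith [Real.one_le_exp (mul_nonneg hb ht)]
  have hm0 : Measurable fun x => ENNReal.ofReal (decay b (σ x)) := by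
    simpa using h.measurable_decay 0
  have hm4 : Measurable ({x | σ x < 4}.indicator fun _ => ENNReal.ofReal (Real.exp (-(b * 3)))) :=
    measurable_const.indicator (h.measurableSet_lt 4)
  have hpt : ∀ x, ENNReal.ofReal (decay b (σ x - t)) ≤ ENNReal.ofReal (decay b (σ x)) +
      ENNReal.ofReal (Real.exp (b * t) - 1) * (ENNReal.ofReal (decay b (σ x)) +
        {x | σ x < 4}.indicator (fun _ => ENNReal.ofReal (Real.exp (-(b * 3)))) x) := by
    intro x
    by_cases hx : σ x < 4
    · rw [Set.indicator_of_mem (by exact hx), ← ENNReal.ofReal_add (decay_nonneg hb _)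
        (Real.exp_pos _).le, ← ENNReal.ofReal_mul he, ← ENNReal.ofReal_add (decay_nonneg hb _)
        (mul_nonneg he (add_nonneg (decay_nonneg hb _) (Real.exp_pos _).le))]
      exact ENNReal.ofReal_le_ofReal (decay_sub_le hb ht _)
    · rw [decay_of_three_le b (by linarith)]
      simp
  refine (lintegral_mono hpt).trans ?_
  rw [lintegral_add_left hm0, lintegral_const_mul' _ _ ENNReal.ofReal_ne_top, lintegral_add_left hm0,
    lintegral_indicator_const (h.measurableSet_lt 4), ← decayMeasure_univ,
    ENNReal.ofReal_add zero_le_one (by linarith), ENNReal.ofReal_one, add_mul, one_mul,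
    ENNReal.ofReal_mul zero_le_two, mul_comm (ENNReal.ofReal 2), mul_assoc]
  gcongr
  rw [ENNReal.ofReal_ofNat, two_mul]
  gcongr
  exact h.exp_mul_le

theorem HasGrowth.lintegral_max_le {b t ε : ℝ} (hb : 0 ≤ b) (ht : 0 ≤ t) (ht1 : t ≤ 1)
    (hbt : b * t ≤ 1) (hε : 0 ≤ ε) (hε1 : ε ≤ 1)
    {ν H : Measure Ω} {σ σ' : Ω → ℝ} (h : HasGrowth b ν σ)
    (hH : ∀ s, 1 ≤ s → s ≤ 4 → H {x | σ x < s} ≤ ENNReal.ofReal (1 + ε) * ν {x | σ x < s})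
    (hσ : ∀ x, σ' x < 3 → σ x ≤ σ' x + t) :
    ∫⁻ x, max (ENNReal.ofReal (decay b (σ x))) (ENNReal.ofReal (decay b (σ' x))) ∂H ≤
      ENNReal.ofReal (1 + (ε + 8 * (b * t))) * decayMeasure b ν σ Set.univ := by
  calc ∫⁻ x, max (ENNReal.ofReal (decay b (σ x))) (ENNReal.ofReal (decay b (σ' x))) ∂H
      ≤ ∫⁻ x, ENNReal.ofReal (decay b (σ x - t)) ∂H := by
        refine lintegral_mono fun x => max_le ?_ ?_
        · exact ENNReal.ofReal_le_ofReal (decay_antitone hb (by linarith))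
        · by_cases hx : σ' x < 3
          · exact ENNReal.ofReal_le_ofReal (decay_antitone hb (by linarith [hσ x hx]))
          · rw [decay_of_three_le b (not_lt.1 hx)]; simp
    _ ≤ ENNReal.ofReal (1 + ε) * ∫⁻ x, ENNReal.ofReal (decay b (σ x - t)) ∂ν := by
        refine lintegral_antitone_le (g := fun s => decay b (s - t)) h.measurable
          (fun r s hrs => decay_antitone hb (by linarith)) ((continuous_decay b).comp (by fun_prop))
          (fun s => decay_nonneg hb _) (fun s hs => ?_) (fun s hs => ?_) ENNReal.ofReal_ne_top hH
        · rw [decay_of_le_one b (by linarith : s - t ≤ 1), decay_of_le_one b (by linarith : 1 - t ≤ 1)]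
        · exact decay_of_three_le b (by linarith)
    _ ≤ ENNReal.ofReal (1 + ε) *
        (ENNReal.ofReal (1 + 2 * (Real.exp (b * t) - 1)) * decayMeasure b ν σ Set.univ) := by
        gcongr
        exact h.lintegral_shift_le hb ht ht1
    _ ≤ _ := by
        rw [← mul_assoc, ← ENNReal.ofReal_mul (by linarith)]
        gcongr
        have hbt0 : 0 ≤ b * t := mul_nonneg hb ht
        have h1 : Real.exp (b * t) - 1 ≤ 2 * (b * t) := by
          have h2 := Real.abs_exp_sub_one_le (x := b * t) (by rwa [abs_of_nonneg hbt0])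
          rw [abs_of_nonneg hbt0] at h2
          exact (le_abs_self _).trans h2
        -- With `ε ≤ 1`, `(1 + ε)(1 + 4bt) ≤ 1 + ε + 8bt`.
        nlinarith

/-- The bound is the larger of the two densities against `H`, divided by the smaller of the two
normalising masses. -/
theorem exists_common_bound_aux {b t ε : ℝ} (hb : 0 < b)
    {ν ν' H : Measure Ω} {σ σ' : Ω → ℝ} (h : HasGrowth b ν σ)
    (hν : ν ≤ H) (hν' : ν' ≤ H)
    (hZ : decayMeasure b ν σ Set.univ ≤ decayMeasure b ν' σ' Set.univ)
    (hmax : ∫⁻ x, max (ENNReal.ofReal (decay b (σ x))) (ENNReal.ofReal (decay b (σ' x))) ∂H ≤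
      ENNReal.ofReal (1 + (ε + 8 * (b * t))) * decayMeasure b ν σ Set.univ) :
    ∃ G : Measure Ω, decayKernel b ν σ ≤ G ∧ decayKernel b ν' σ' ≤ G ∧
      G Set.univ ≤ ENNReal.ofReal (1 + (ε + 8 * (b * t))) := by
  have hle : ∀ {ν₁ : Measure Ω} {f g : Ω → ℝ≥0∞}, ν₁ ≤ H → f ≤ g →
      ν₁.withDensity f ≤ H.withDensity g := by
    intro ν₁ f g h1 h2
    refine Measure.le_iff.2 fun A hA => ?_
    rw [withDensity_apply _ hA, withDensity_apply _ hA]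
    exact lintegral_mono' (Measure.restrict_mono subset_rfl h1) h2
  refine ⟨(decayMeasure b ν σ Set.univ)⁻¹ • H.withDensity fun x =>
    max (ENNReal.ofReal (decay b (σ x))) (ENNReal.ofReal (decay b (σ' x))), ?_, ?_, ?_⟩
  · refine Measure.le_iff.2 fun A _ => ?_
    rw [decayKernel, Measure.smul_apply, Measure.smul_apply, smul_eq_mul, smul_eq_mul]
    exact mul_le_mul_right (hle hν (fun x => le_max_left _ _) A) _
  · refine Measure.le_iff.2 fun A _ => ?_
    rw [decayKernel, Measure.smul_apply, Measure.smul_apply, smul_eq_mul, smul_eq_mul]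
    exact mul_le_mul' (ENNReal.inv_le_inv.2 hZ) (hle hν' (fun x => le_max_right _ _) A)
  · rw [Measure.smul_apply, smul_eq_mul, withDensity_apply _ MeasurableSet.univ,
      Measure.restrict_univ]
    refine (mul_le_mul_right hmax _).trans ?_
    rw [mul_left_comm, ENNReal.inv_mul_cancel (h.decayMeasure_pos hb)
      (h.decayMeasure_ne_top hb.le), mul_one]

/-- Two kernels built from comparable data have a common upper bound of mass close to `1`. -/
theorem exists_common_bound {b t ε : ℝ} (hb : 1 ≤ b) (ht : 0 ≤ t) (hε : 0 ≤ ε)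
    {ν ν' : Measure Ω} {σ σ' : Ω → ℝ} (h : HasGrowth b ν σ) (h' : HasGrowth b ν' σ')
    (hH : ε ≤ 1 → ∃ H : Measure Ω, ν ≤ H ∧ ν' ≤ H ∧
      (∀ s, 1 ≤ s → s ≤ 4 → H {x | σ x < s} ≤ ENNReal.ofReal (1 + ε) * ν {x | σ x < s}) ∧
      (∀ s, 1 ≤ s → s ≤ 4 → H {x | σ' x < s} ≤ ENNReal.ofReal (1 + ε) * ν' {x | σ' x < s}))
    (hσ : ∀ x, σ' x < 3 → σ x ≤ σ' x + t) (hσ' : ∀ x, σ x < 3 → σ' x ≤ σ x + t) :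
    ∃ G : Measure Ω, decayKernel b ν σ ≤ G ∧ decayKernel b ν' σ' ≤ G ∧
      G Set.univ ≤ ENNReal.ofReal (1 + (ε + 8 * (b * t))) := by
  have hb0 : 0 < b := by linarith
  have hbt0 : 0 ≤ b * t := mul_nonneg hb0.le ht
  by_cases hbig : ε ≤ 1 ∧ b * t ≤ 1
  · obtain ⟨H, hν, hν', h1, h2⟩ := hH hbig.1
    have ht1 : t ≤ 1 := by nlinarith [hbig.2]
    have m1 := h.lintegral_max_le hb0.le ht ht1 hbig.2 hε hbig.1 h1 hσ
    have m2 := h'.lintegral_max_le hb0.le ht ht1 hbig.2 hε hbig.1 h2 hσ'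
    rcases le_total (decayMeasure b ν σ Set.univ) (decayMeasure b ν' σ' Set.univ) with hZ | hZ
    · exact exists_common_bound_aux hb0 h hν hν' hZ m1
    · obtain ⟨G, a, b, c⟩ := exists_common_bound_aux hb0 h' hν' hν hZ m2
      exact ⟨G, b, a, c⟩
  -- If `ε` or `b * t` exceeds `1`, the allowed mass is at least `2` and the sum of the kernels
  -- suffices.
  · refine ⟨decayKernel b ν σ + decayKernel b ν' σ', Measure.le_add_right le_rfl,
      Measure.le_add_left le_rfl, ?_⟩
    rw [Measure.add_apply, h.decayKernel_univ hb0, h'.decayKernel_univ hb0]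
    rw [← ENNReal.ofReal_one, ← ENNReal.ofReal_add zero_le_one zero_le_one]
    refine ENNReal.ofReal_le_ofReal ?_
    by_contra hlt
    exact hbig ⟨by linarith, by linarith⟩

end

/-! ### Product measures and `p`-norms -/

section PiLpNorm

variable {ι : Type*} [Fintype ι] (p : ℝ≥0∞) [Fact (1 ≤ p)]

theorem PiLp.norm_toLp_mono {x y : ι → ℝ} (h : ∀ i, |x i| ≤ |y i|) :
    ‖(WithLp.toLp p x : PiLp p fun _ : ι => ℝ)‖ ≤ ‖(WithLp.toLp p y : PiLp p fun _ : ι => ℝ)‖ := by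
  rcases eq_or_ne p ⊤ with rfl | hp
  · rw [PiLp.norm_eq_ciSup, PiLp.norm_eq_ciSup]
    exact ciSup_mono (Set.finite_range _).bddAbove h
  · have hp0 : 0 < p.toReal :=
      ENNReal.toReal_pos (zero_lt_one.trans_le (Fact.out : 1 ≤ p)).ne' hp
    rw [PiLp.norm_eq_sum hp0, PiLp.norm_eq_sum hp0]
    refine Real.rpow_le_rpow (Finset.sum_nonneg fun i _ => by positivity) ?_ (by positivity)
    exact Finset.sum_le_sum fun i _ => Real.rpow_le_rpow (norm_nonneg _) (h i) hp0.le

theorem PiLp.norm_toLp_le_sum (x : ι → ℝ) :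
    ‖(WithLp.toLp p x : PiLp p fun _ : ι => ℝ)‖ ≤ ∑ i, |x i| := by
  classical
  have hx : (WithLp.toLp p x : PiLp p fun _ : ι => ℝ) = ∑ i, PiLp.single p i (x i) := by
    ext j
    simp [WithLp.ofLp_sum]
  rw [hx]
  refine (norm_sum_le _ _).trans (Finset.sum_le_sum fun i _ => ?_)
  rw [PiLp.norm_single]
  rfl

theorem PiLp.dist_eq_norm_toLp {M : ι → Type*} [∀ i, MetricSpace (M i)] (x y : PiLp p M) :
    dist x y = ‖(WithLp.toLp p fun i => dist (x i) (y i) : PiLp p fun _ : ι => ℝ)‖ := by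
  rcases eq_or_ne p ⊤ with rfl | hp
  · rw [PiLp.norm_eq_ciSup, PiLp.dist_eq_iSup]
    simp
  · have hp0 : 0 < p.toReal :=
      ENNReal.toReal_pos (zero_lt_one.trans_le (Fact.out : 1 ≤ p)).ne' hp
    rw [PiLp.norm_eq_sum hp0, PiLp.dist_eq_sum hp0]
    simp

theorem PiLp.sum_mul_le_norm_mul_norm {q : ℝ≥0∞} (hpq : 1 / p + 1 / q = 1) {x y : ι → ℝ}
    (hy : ∀ i, 0 ≤ y i) :
    ∑ i, x i * y i ≤ ‖(WithLp.toLp q x : PiLp q fun _ : ι => ℝ)‖ *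
      ‖(WithLp.toLp p y : PiLp p fun _ : ι => ℝ)‖ := by
  have hp1 : 1 ≤ p := Fact.out
  rcases eq_or_ne p ⊤ with rfl | hp
  · have hq : q = 1 := by simpa using hpq
    subst hq
    rw [PiLp.norm_eq_of_L1, Finset.sum_mul]
    refine Finset.sum_le_sum fun i _ => mul_le_mul (le_abs_self _) ?_ (hy i) (norm_nonneg _)
    exact (le_abs_self _).trans
      (PiLp.norm_apply_le (WithLp.toLp ⊤ y : PiLp ⊤ fun _ : ι => ℝ) i)
  rcases eq_or_ne q ⊤ with rfl | hq
  · have hp : p = 1 := by simpa using hpq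
    subst hp
    rw [PiLp.norm_eq_of_L1, Finset.mul_sum]
    refine Finset.sum_le_sum fun i _ => mul_le_mul ?_ (le_abs_self _) (hy i) (norm_nonneg _)
    exact (le_abs_self _).trans
      (PiLp.norm_apply_le (WithLp.toLp ⊤ x : PiLp ⊤ fun _ : ι => ℝ) i)
  · have hp0 : p ≠ 0 := (zero_lt_one.trans_le hp1).ne'
    have hq0 : q ≠ 0 := by
      rintro rfl
      simp at hpq
    have hconj : p.toReal.HolderConjugate q.toReal := by
      have h1 := congrArg ENNReal.toReal hpq
      rw [one_div, one_div, ENNReal.toReal_add (ENNReal.inv_ne_top.2 hp0)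
        (ENNReal.inv_ne_top.2 hq0), ENNReal.toReal_inv, ENNReal.toReal_inv,
        ENNReal.toReal_one] at h1
      exact Real.holderConjugate_iff.2 ⟨by
        have hqpos := inv_pos.2 (ENNReal.toReal_pos hq0 hq)
        have hppos := ENNReal.toReal_pos hp0 hp
        have : p.toReal⁻¹ < 1 := by linarith
        exact (inv_lt_one₀ hppos).1 this, h1⟩
    rw [PiLp.norm_eq_sum (ENNReal.toReal_pos hp0 hp), PiLp.norm_eq_sum (ENNReal.toReal_pos hq0 hq)]
    exact Real.inner_le_Lp_mul_Lq _ _ _ hconj.symm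

end PiLpNorm

/-- Sublevel sets of a coercive monotone function on `[0, ∞)` are half-open intervals. -/
theorem exists_sublevel_iff {φ : ℝ → ℝ} (hc : Continuous φ) (hm : MonotoneOn φ (Set.Ici 0))
    (hφ : ∀ u, u ≤ φ u) (s : ℝ) :
    (∀ u, 0 ≤ u → ¬ φ u < s) ∨ ∃ s' > 0, ∀ u, 0 ≤ u → (φ u < s ↔ u < s') := by
  by_cases h0 : φ 0 < s
  · right
    let W : Set ℝ := {u | 0 ≤ u ∧ s ≤ φ u}
    have hW : IsClosed W :=
      (isClosed_le continuous_const continuous_id).inter (isClosed_le continuous_const hc)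
    have hne : W.Nonempty := ⟨max s 0, le_max_right _ _, (le_max_left _ _).trans (hφ _)⟩
    have hb : BddBelow W := ⟨0, fun u hu => hu.1⟩
    have hs := hW.csInf_mem hne hb
    refine ⟨sInf W, lt_of_le_of_ne hs.1 fun h => ?_, fun u hu => ⟨fun h => ?_, fun h => ?_⟩⟩
    · have := hs.2
      rw [← h] at this
      linarith
    · by_contra hlt
      have := hm hs.1 hu (not_lt.1 hlt)
      linarith [hs.2]
    · by_contra hlt
      exact absurd (csInf_le hb (show u ∈ W from ⟨hu, not_lt.1 hlt⟩)) (not_le.2 h)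
  · left
    exact fun u hu h => h0 ((hm Set.self_mem_Ici hu hu).trans_lt h)

section Pi

variable {ι : Type*} [Fintype ι] {M : ι → Type*} [∀ i, MeasurableSpace (M i)]

theorem lintegral_pi_le_of_coordinate [DecidableEq ι] (i : ι) {μ μ' : ∀ i, Measure (M i)}
    [∀ i, SigmaFinite (μ i)] [∀ i, SigmaFinite (μ' i)] (hμ : ∀ j, j ≠ i → μ j = μ' j)
    {f g : (∀ i, M i) → ℝ≥0∞} (hf : Measurable f) (hg : Measurable g) {c : ℝ≥0∞} (hc : c ≠ ⊤)
    (h : ∀ x, ∫⁻ y, f (Function.update x i y) ∂μ i ≤ c * ∫⁻ y, g (Function.update x i y) ∂μ' i) :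
    ∫⁻ x, f x ∂Measure.pi μ ≤ c * ∫⁻ x, g x ∂Measure.pi μ' := by
  rcases isEmpty_or_nonempty (∀ i, M i) with hE | ⟨⟨x⟩⟩
  · simp [lintegral_of_isEmpty]
  · rw [lintegral_eq_lmarginal_univ x, lintegral_eq_lmarginal_univ x,
      lmarginal_erase' _ hf (Finset.mem_univ i), lmarginal_erase' _ hg (Finset.mem_univ i),
      lmarginal, lmarginal]
    have he : (fun j : Finset.univ.erase i => μ j) = fun j : Finset.univ.erase i => μ' j :=
      funext fun j => hμ j (Finset.ne_of_mem_erase j.2)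
    rw [he, ← lintegral_const_mul' _ _ hc]
    exact lintegral_mono fun y => h _

/-- Hybrid argument: `T` is the set of coordinates already switched from `ν` to `η`. Each switch is
a one-dimensional comparison by Fubini. -/
theorem lintegral_pi_le_of_coordinates [DecidableEq ι] {η ν : ∀ i, Measure (M i)}
    [∀ i, SigmaFinite (η i)] [∀ i, SigmaFinite (ν i)] {c : ι → ℝ≥0∞} (hc : ∀ i, c i ≠ ⊤)
    {F : Finset ι → (∀ i, M i) → ℝ≥0∞} (hF : ∀ T, Measurable (F T))
    (h : ∀ i T, i ∉ T → ∀ x, ∫⁻ y, F (insert i T) (Function.update x i y) ∂η i ≤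
      c i * ∫⁻ y, F T (Function.update x i y) ∂ν i) :
    ∫⁻ x, F Finset.univ x ∂Measure.pi η ≤ (∏ i, c i) * ∫⁻ x, F ∅ x ∂Measure.pi ν := by
  let mix : Finset ι → ∀ i, Measure (M i) := fun T i => if i ∈ T then η i else ν i
  have hmix : ∀ T i, SigmaFinite (mix T i) := fun T i => by
    by_cases hi : i ∈ T <;> simp only [mix, hi, if_true, if_false] <;> infer_instance
  have key : ∀ T : Finset ι, ∫⁻ x, F T x ∂Measure.pi (mix T) ≤
      (∏ i ∈ T, c i) * ∫⁻ x, F ∅ x ∂Measure.pi ν := by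
    intro T
    induction T using Finset.induction_on with
    | empty => simp [mix]
    | insert i T hi ih =>
      have h1 : ∫⁻ x, F (insert i T) x ∂Measure.pi (mix (insert i T)) ≤
          c i * ∫⁻ x, F T x ∂Measure.pi (mix T) := by
        refine lintegral_pi_le_of_coordinate i (fun j hj => ?_) (hF _) (hF _) (hc i) fun x => ?_
        · simp [mix, hj]
        · simpa [mix, hi] using h i T hi x
      refine h1.trans ?_
      rw [Finset.prod_insert hi, mul_assoc]
      exact mul_le_mul_right ih _
  simpa [mix] using key Finset.univ

theorem Measure.pi_le_pi {η ν : ∀ i, Measure (M i)} [∀ i, SigmaFinite (η i)]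
    [∀ i, SigmaFinite (ν i)] (h : ∀ i, ν i ≤ η i) : Measure.pi ν ≤ Measure.pi η := by
  classical
  refine Measure.le_iff.2 fun A hA => ?_
  rw [← lintegral_indicator_one hA, ← lintegral_indicator_one hA]
  have := lintegral_pi_le_of_coordinates (η := ν) (ν := η) (c := fun _ => 1) (by simp)
    (F := fun _ => A.indicator 1) (fun _ => measurable_one.indicator hA)
    (fun i T _ x => by rw [one_mul]; exact lintegral_mono' (h i) le_rfl)
  simpa using this

/-- Coordinatewise comparison of sublevel sets passes to sublevel sets of `p`-norms. -/
theorem pi_sublevel_le (p : ℝ≥0∞) [Fact (1 ≤ p)] {η ν : ∀ i, Measure (M i)}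
    [∀ i, SigmaFinite (η i)] [∀ i, SigmaFinite (ν i)] {c : ι → ℝ≥0∞} (hc : ∀ i, c i ≠ ⊤)
    {t' t : ∀ i, M i → ℝ} (ht' : ∀ i, Measurable (t' i)) (ht : ∀ i, Measurable (t i))
    (ht'0 : ∀ i y, 0 ≤ t' i y) (ht0 : ∀ i y, 0 ≤ t i y)
    (h : ∀ i s, 0 < s → η i {y | t' i y < s} ≤ c i * ν i {y | t i y < s}) (s : ℝ) :
    Measure.pi η {x | ‖(WithLp.toLp p fun i => t' i (x i) : PiLp p fun _ : ι => ℝ)‖ < s} ≤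
      (∏ i, c i) *
        Measure.pi ν {x | ‖(WithLp.toLp p fun i => t i (x i) : PiLp p fun _ : ι => ℝ)‖ < s} := by
  classical
  let m : Finset ι → ∀ i, M i → ℝ := fun T i => if i ∈ T then t' i else t i
  have hm : ∀ T i, Measurable (m T i) := fun T i => by
    by_cases hi : i ∈ T <;> simp only [m, hi, if_true, if_false]
    exacts [ht' i, ht i]
  let A : Finset ι → Set (∀ i, M i) := fun T =>
    {x | ‖(WithLp.toLp p fun i => m T i (x i) : PiLp p fun _ : ι => ℝ)‖ < s}
  have hA : ∀ T, MeasurableSet (A T) := by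
    intro T
    refine measurableSet_lt ?_ measurable_const
    have h1 : Measurable fun x : ∀ i, M i => fun i => m T i (x i) :=
      measurable_pi_lambda _ fun i => (hm T i).comp (measurable_pi_apply i)
    exact ((PiLp.continuous_toLp p (fun _ : ι => ℝ)).norm.measurable).comp h1
  have key := lintegral_pi_le_of_coordinates (η := η) (ν := ν) hc
    (F := fun T => (A T).indicator 1) (fun T => measurable_one.indicator (hA T)) (by
    intro i T hi x
    let τ : ι → ℝ := fun j => m T j (x j)
    let φ : ℝ → ℝ := fun u => ‖(WithLp.toLp p (Function.update τ i u) : PiLp p fun _ : ι => ℝ)‖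
    have hφc : Continuous φ := (PiLp.continuous_toLp p (fun _ : ι => ℝ)).norm.comp
      (continuous_const.update i continuous_id)
    have hφm : MonotoneOn φ (Set.Ici 0) := by
      intro u hu v _ huv
      refine PiLp.norm_toLp_mono p fun j => ?_
      rcases eq_or_ne j i with rfl | hj
      · simp only [Function.update_self]
        exact abs_le_abs_of_nonneg hu huv
      · simp [hj]
    have hφ : ∀ u, u ≤ φ u := fun u => by
      have := PiLp.norm_apply_le
        (WithLp.toLp p (Function.update τ i u) : PiLp p fun _ : ι => ℝ) i
      simp only [Function.update_self] at this
      exact (le_abs_self u).trans this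
    have e1 : ∀ y, Function.update x i y ∈ A (insert i T) ↔ φ (t' i y) < s := by
      intro y
      have : (fun j => m (insert i T) j (Function.update x i y j)) =
          Function.update τ i (t' i y) := by
        funext j
        rcases eq_or_ne j i with rfl | hj
        · simp [m]
        · simp [m, τ, hj]
      simp only [A, φ, Set.mem_ofPred_eq, this]
    have e2 : ∀ y, Function.update x i y ∈ A T ↔ φ (t i y) < s := by
      intro y
      have : (fun j => m T j (Function.update x i y j)) = Function.update τ i (t i y) := by
        funext j
        rcases eq_or_ne j i with rfl | hj
        · simp [m, hi]
        · simp [τ, hj]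
      simp only [A, φ, Set.mem_ofPred_eq, this]
    have i1 : ∀ (θ : Measure (M i)) (B : Set (∀ i, M i)), MeasurableSet B →
        ∫⁻ y, B.indicator 1 (Function.update x i y) ∂θ =
          θ {y | Function.update x i y ∈ B} := by
      intro θ B hB
      exact lintegral_indicator_one (μ := θ) (measurable_update x hB)
    rw [i1 _ _ (hA _), i1 _ _ (hA _)]
    simp only [e1, e2]
    -- The fibre is empty or a one-coordinate sublevel set at some level `s'`, possibly tiny; hence
    -- the hypothesis at every positive level.
    rcases exists_sublevel_iff hφc hφm hφ s with hno | ⟨s', hs', hiff⟩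
    · simp [hno _ (ht'0 i _)]
    · simp only [hiff _ (ht'0 i _), hiff _ (ht0 i _)]
      exact h i s' hs')
  rw [lintegral_indicator_one (hA _), lintegral_indicator_one (hA _)] at key
  simpa [A, m] using key

end Pi

/-! ### Families of measures of pointwise homogeneous type -/

/-- For finite measures this is the adjunction for truncated subtraction; the general case exhausts
the space by sets of finite `μ + ν`-measure. -/
theorem Measure.le_add_sub {α : Type*} [MeasurableSpace α] (μ ν : Measure α) [SigmaFinite μ]
    [SigmaFinite ν] : μ ≤ ν + (μ - ν) := by
  refine Measure.le_iff.2 fun A hA => ?_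
  let B := spanningSets (μ + ν)
  have hBm : ∀ n, MeasurableSet (B n) := measurableSet_spanningSets _
  have hfin : ∀ n, (μ + ν) (B n) < ⊤ := measure_spanningSets_lt_top _
  have hA' : A = ⋃ n, A ∩ B n := by
    rw [← Set.inter_iUnion, iUnion_spanningSets, Set.inter_univ]
  have hmono : Monotone fun n => A ∩ B n := fun a b hab =>
    Set.inter_subset_inter_right _ (monotone_spanningSets _ hab)
  conv_lhs => rw [hA', hmono.measure_iUnion]
  refine iSup_le fun n => ?_
  have h1 : IsFiniteMeasure (μ.restrict (B n)) :=
    isFiniteMeasure_restrict.2 ((Measure.le_add_right le_rfl : μ ≤ μ + ν) _ |>.trans_lt (hfin n)).ne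
  have h2 : IsFiniteMeasure (ν.restrict (B n)) :=
    isFiniteMeasure_restrict.2 ((Measure.le_add_left le_rfl : ν ≤ μ + ν) _ |>.trans_lt (hfin n)).ne
  have h3 : μ.restrict (B n) ≤ (μ - ν).restrict (B n) + ν.restrict (B n) := by
    rw [Measure.restrict_sub_eq_restrict_sub_restrict (hBm n)]
    exact Measure.sub_le_iff_le_add.1 le_rfl
  have h4 := h3 A
  rw [Measure.restrict_apply hA, Measure.add_apply, Measure.restrict_apply hA,
    Measure.restrict_apply hA] at h4
  rw [Measure.add_apply, add_comm]
  exact h4.trans (add_le_add (measure_mono Set.inter_subset_left)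
    (measure_mono Set.inter_subset_left))

namespace IsPointwiseHomogeneous

variable {M : Type*} [MetricSpace M] [MeasurableSpace M] {μ : M → Measure M}

theorem sigmaFinite (h : IsPointwiseHomogeneous μ) (x : M) : SigmaFinite (μ x) :=
  ⟨⟨{ set := fun n => ball x (n + 1)
      set_mem := fun _ => trivial
      finite := fun n => (h.doublingAt x).finite _ (by positivity)
      spanning := by
        refine Set.eq_univ_of_forall fun y => Set.mem_iUnion.2 ?_
        obtain ⟨n, hn⟩ := exists_nat_gt (dist y x)
        exact ⟨n, by rw [mem_ball]; linarith⟩ }⟩⟩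

theorem measure_ball_two_mul_le (h : IsPointwiseHomogeneous μ) (x : M) {R : ℝ} (hR : 0 < R) :
    μ x (ball x (2 * R)) ≤ doublingConst μ * μ x (ball x R) := by
  have h1 : μ x (ball x (2 * R)) / μ x (ball x R) ≤ doublingConst μ :=
    (le_iSup₂ (f := fun (R : ℝ) (_ : 0 < R) => μ x (ball x (2 * R)) / μ x (ball x R)) R hR).trans
      (le_iSup (fun m => doublingConstAt (μ m) m) x)
  exact (ENNReal.div_le_iff ((h.doublingAt x).pos R hR).ne' ((h.doublingAt x).finite R hR).ne).1 h1

theorem measure_ball_pow_le (h : IsPointwiseHomogeneous μ) (x : M) {R : ℝ} (hR : 0 < R) (k : ℕ) :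
    μ x (ball x (2 ^ k * R)) ≤ doublingConst μ ^ k * μ x (ball x R) := by
  induction k with
  | zero => simp
  | succ k ih =>
    rw [pow_succ', mul_assoc, pow_succ', mul_assoc]
    exact (h.measure_ball_two_mul_le x (by positivity)).trans (mul_le_mul_right ih _)

theorem one_le_doublingConst (h : IsPointwiseHomogeneous μ) (x : M) : 1 ≤ doublingConst μ := by
  have h1 := (measure_mono (ball_subset_ball (by norm_num : (1 : ℝ) ≤ 2 * 1))).trans
    (h.measure_ball_two_mul_le x one_pos)
  have h2 := (h.doublingAt x).pos 1 one_pos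
  have h3 := (h.doublingAt x).finite 1 one_pos
  by_contra hlt
  have h4 := ENNReal.mul_lt_mul_left h2.ne' h3.ne (not_le.1 hlt)
  rw [one_mul] at h4
  exact absurd h1 (not_le.2 h4)

/-- The infimum is attained: for fixed points and radius the condition is closed in `C`, because the
coefficient of `C` is finite. -/
theorem isConsistentWith_consistencyConst (h : IsPointwiseHomogeneous μ) :
    IsConsistentWith μ (consistencyConst μ) := by
  intro m₁ m₂ m R hm hR
  obtain ⟨C, -, hC, hCmem⟩ := exists_seq_tendsto_sInf (S := {C : ℝ≥0 | IsConsistentWith μ C})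
    h.consistent (OrderBot.bddBelow _)
  have hne : μ m (ball m R) / ENNReal.ofReal R * edist m₁ m₂ ≠ ⊤ :=
    ENNReal.mul_ne_top (ENNReal.div_ne_top ((h.doublingAt m).finite R hR).ne
      (ENNReal.ofReal_pos.2 hR).ne') (edist_ne_top _ _)
  have hlim : Filter.Tendsto (fun n => (C n : ℝ≥0∞) * (μ m (ball m R) / ENNReal.ofReal R *
      edist m₁ m₂)) Filter.atTop (nhds ((consistencyConst μ : ℝ≥0∞) *
        (μ m (ball m R) / ENNReal.ofReal R * edist m₁ m₂))) :=
    ENNReal.Tendsto.mul_const (ENNReal.tendsto_coe.2 hC) (Or.inr hne)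
  rw [mul_assoc]
  refine ge_of_tendsto' hlim fun n => ?_
  rw [← mul_assoc]
  exact hCmem n m₁ m₂ m R hm hR

theorem variationDiff_ball_le (h : IsPointwiseHomogeneous μ) (x y z : M) (hz : z = x ∨ z = y)
    {R : ℝ} (hR : 0 < R) : variationDiff (μ x) (μ y) (ball z R) ≤
      ENNReal.ofReal (consistencyConst μ * dist x y / R) * μ z (ball z R) := by
  refine (h.isConsistentWith_consistencyConst x y z R hz hR).trans (le_of_eq ?_)
  rw [ENNReal.ofReal_div_of_pos hR, ENNReal.ofReal_mul (NNReal.coe_nonneg _),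
    ENNReal.ofReal_coe_nnreal, edist_dist, div_eq_mul_inv, div_eq_mul_inv]
  ring

/-- If the doubling constant is less than `2`, then all measures of the family agree on balls. -/
theorem variationDiff_eq_zero (h : IsPointwiseHomogeneous μ) (hD : doublingConst μ < 2) (x y : M)
    {R : ℝ} (hR : 0 < R) : variationDiff (μ x) (μ y) (ball x R) = 0 := by
  have hmono : ∀ {A B : Set M}, A ⊆ B → variationDiff (μ x) (μ y) A ≤ variationDiff (μ x) (μ y) B :=
    fun hAB => add_le_add (measure_mono hAB) (measure_mono hAB)
  set c : ℝ≥0∞ := ENNReal.ofReal (consistencyConst μ * dist x y / R) * μ x (ball x R) with hc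
  have hcne : c ≠ ⊤ := ENNReal.mul_ne_top ENNReal.ofReal_ne_top ((h.doublingAt x).finite R hR).ne
  -- Apply consistency on the ball of radius `2 ^ k * R`: the mass grows by at most `D ^ k`, while
  -- the radius in the denominator gains `2 ^ k`.
  have hbound : ∀ k : ℕ, variationDiff (μ x) (μ y) (ball x R) ≤ (doublingConst μ / 2) ^ k * c := by
    intro k
    have hk : (1 : ℝ) ≤ 2 ^ k := one_le_pow₀ one_le_two
    refine (hmono (ball_subset_ball (by nlinarith : R ≤ 2 ^ k * R))).trans
      ((h.variationDiff_ball_le x y x (Or.inl rfl) (by positivity)).trans ?_)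
    have e : (consistencyConst μ : ℝ) * dist x y / (2 ^ k * R) =
        (consistencyConst μ * dist x y / R) / 2 ^ k := by
      rw [div_div, mul_comm R]
    rw [e, ENNReal.ofReal_div_of_pos (by positivity), ENNReal.ofReal_pow zero_le_two,
      ENNReal.ofReal_ofNat, hc]
    calc _ ≤ ENNReal.ofReal (consistencyConst μ * dist x y / R) / 2 ^ k *
          (doublingConst μ ^ k * μ x (ball x R)) := mul_le_mul_right (h.measure_ball_pow_le x hR k) _
      _ = _ := by
        simp only [div_eq_mul_inv, mul_pow, ENNReal.inv_pow]
        ring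
  have hlt : doublingConst μ / 2 < 1 := by
    rw [ENNReal.div_lt_iff (Or.inl two_ne_zero) (Or.inl ENNReal.ofNat_ne_top), one_mul]
    exact hD
  have hlim := ENNReal.Tendsto.mul_const (b := c)
    (ENNReal.tendsto_pow_atTop_nhds_zero_of_lt_one hlt) (Or.inr hcne)
  rw [zero_mul] at hlim
  exact le_antisymm (ge_of_tendsto' hlim hbound) zero_le

/-- Two disjoint balls, the one at `x` being the lighter, lie in the concentric ball of four times
the radius about `x`. -/
theorem two_le_sq_doublingConst_aux [BorelSpace M] (h : IsPointwiseHomogeneous μ) {x y : M} (hxy : x ≠ y)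
    (hle : μ x (ball x (dist x y / 2)) ≤ μ x (ball y (dist x y / 2))) :
    2 ≤ doublingConst μ ^ 2 := by
  have hd : 0 < dist x y := dist_pos.2 hxy
  have hdisj : Disjoint (ball x (dist x y / 2)) (ball y (dist x y / 2)) :=
    ball_disjoint_ball (by linarith)
  have h1 : 2 * μ x (ball x (dist x y / 2)) ≤
      doublingConst μ ^ 2 * μ x (ball x (dist x y / 2)) := by
    calc 2 * μ x (ball x (dist x y / 2))
        ≤ μ x (ball x (dist x y / 2)) + μ x (ball y (dist x y / 2)) := by
          rw [two_mul]; gcongr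
      _ = μ x (ball x (dist x y / 2) ∪ ball y (dist x y / 2)) :=
          (measure_union hdisj measurableSet_ball).symm
      _ ≤ μ x (ball x (2 ^ 2 * (dist x y / 2))) := by
          refine measure_mono (Set.union_subset (ball_subset_ball (by linarith)) ?_)
          exact ball_subset_ball' (by rw [dist_comm y x]; linarith)
      _ ≤ _ := h.measure_ball_pow_le x (by linarith) 2
  exact (ENNReal.mul_le_mul_iff_left ((h.doublingAt x).pos _ (by linarith)).ne'
    ((h.doublingAt x).finite _ (by linarith)).ne).1 h1

/-- The doubling constant of a space with at least two points is at least `√2`. -/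
theorem two_le_sq_doublingConst [BorelSpace M] (h : IsPointwiseHomogeneous μ) {x y : M} (hxy : x ≠ y) :
    2 ≤ doublingConst μ ^ 2 := by
  by_contra hlt
  have hD : doublingConst μ < 2 := by
    by_contra h2
    refine hlt (le_trans ?_ (pow_le_pow_left' (not_lt.1 h2) 2))
    norm_num
  have := h.sigmaFinite x
  have := h.sigmaFinite y
  have hd : 0 < dist x y := dist_pos.2 hxy
  have hz := h.variationDiff_eq_zero hD x y (R := 2 * dist x y) (by linarith)
  rw [variationDiff, add_eq_zero] at hz
  have e1 : ∀ A ⊆ ball x (2 * dist x y), μ x A ≤ μ y A := fun A hA => by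
    have := Measure.le_add_sub (μ x) (μ y) A
    rwa [Measure.add_apply, measure_mono_null hA hz.1, add_zero] at this
  have e2 : ∀ A ⊆ ball x (2 * dist x y), μ y A ≤ μ x A := fun A hA => by
    have := Measure.le_add_sub (μ y) (μ x) A
    rwa [Measure.add_apply, measure_mono_null hA hz.2, add_zero] at this
  have s1 : ball x (dist x y / 2) ⊆ ball x (2 * dist x y) := ball_subset_ball (by linarith)
  have s2 : ball y (dist x y / 2) ⊆ ball x (2 * dist x y) :=
    ball_subset_ball' (by rw [dist_comm y x]; linarith)
  -- The lighter ball must be centred at the point whose measure is used. The two measures agree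
  -- here, so the roles of `x` and `y` can be exchanged.
  rcases le_total (μ x (ball x (dist x y / 2))) (μ x (ball y (dist x y / 2))) with hle | hle
  · exact hlt (h.two_le_sq_doublingConst_aux hxy hle)
  · refine hlt (h.two_le_sq_doublingConst_aux hxy.symm ?_)
    rw [dist_comm y x]
    exact (e2 _ s2).trans (hle.trans (e1 _ s1))

/-- Take `η = μ y + (μ x - μ y)`, the maximum of the two measures; its excess over either one is
bounded by the variation of their difference. -/
theorem exists_upper_measure (h : IsPointwiseHomogeneous μ) (x y : M) :
    ∃ η : Measure M, SigmaFinite η ∧ μ x ≤ η ∧ μ y ≤ η ∧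
      (∀ R, 0 < R → η (ball x R) ≤
        ENNReal.ofReal (1 + consistencyConst μ * dist x y / R) * μ x (ball x R)) ∧
      (∀ R, 0 < R → η (ball y R) ≤
        ENNReal.ofReal (1 + consistencyConst μ * dist x y / R) * μ y (ball y R)) := by
  have hx := h.sigmaFinite x
  have hy := h.sigmaFinite y
  have hsub : SigmaFinite (μ x - μ y) := Measure.sigmaFinite_of_le (μ x) Measure.sub_le
  have hpos : ∀ R : ℝ, 0 < R → 0 ≤ (consistencyConst μ : ℝ) * dist x y / R := fun R hR => by
    positivity
  refine ⟨μ y + (μ x - μ y), inferInstance, Measure.le_add_sub _ _, Measure.le_add_right le_rfl,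
    fun R hR => ?_, fun R hR => ?_⟩
  · rw [ENNReal.ofReal_add zero_le_one (hpos R hR), ENNReal.ofReal_one, add_mul, one_mul]
    refine le_trans ?_ (add_le_add_right (h.variationDiff_ball_le x y x (Or.inl rfl) hR) _)
    rw [Measure.add_apply, variationDiff]
    have := Measure.le_add_sub (μ y) (μ x) (ball x R)
    rw [Measure.add_apply] at this
    calc _ ≤ (μ x (ball x R) + (μ y - μ x) (ball x R)) + (μ x - μ y) (ball x R) := by gcongr
      _ = _ := by ring
  · rw [ENNReal.ofReal_add zero_le_one (hpos R hR), ENNReal.ofReal_one, add_mul, one_mul]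
    refine le_trans ?_ (add_le_add_right (h.variationDiff_ball_le x y y (Or.inr rfl) hR) _)
    rw [Measure.add_apply, variationDiff]
    gcongr
    exact le_self_add

end IsPointwiseHomogeneous

/-! ### Gauges on products -/

section Gauge

variable {ι : Type*} [Fintype ι] {M : ι → Type*} [∀ i, MetricSpace (M i)]

/-- The part of the distance, measured in units of `R`, that exceeds `ℓ`. -/
def truncDist {E : Type*} [MetricSpace E] (ℓ R : ℝ) (x z : E) : ℝ :=
  max (dist x z / R - ℓ) 0

/-- The `p`-norm of the truncated distances of the coordinates. -/
def coordGauge (p : ℝ≥0∞) (ℓ : ι → ℝ) (R : ℝ) (x z : ∀ i, M i) : ℝ :=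
  ‖(WithLp.toLp p fun i => truncDist (ℓ i) R (x i) (z i) : PiLp p fun _ : ι => ℝ)‖

/-- The `p`-norm of the distances of the coordinates. -/
def coordDist (p : ℝ≥0∞) (x z : ∀ i, M i) : ℝ :=
  ‖(WithLp.toLp p fun i => dist (x i) (z i) : PiLp p fun _ : ι => ℝ)‖

theorem truncDist_nonneg {E : Type*} [MetricSpace E] (ℓ R : ℝ) (x z : E) :
    0 ≤ truncDist ℓ R x z :=
  le_max_right _ _

theorem truncDist_lt_iff {E : Type*} [MetricSpace E] {ℓ R s : ℝ} (hR : 0 < R) (hs : 0 < s)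
    (x z : E) : truncDist ℓ R x z < s ↔ z ∈ ball x (R * (s + ℓ)) := by
  rw [truncDist, max_lt_iff, and_iff_left hs, mem_ball', sub_lt_iff_lt_add, div_lt_iff₀ hR,
    mul_comm]

theorem measurable_truncDist {E : Type*} [MetricSpace E] [MeasurableSpace E] [BorelSpace E]
    (ℓ R : ℝ) (x : E) : Measurable (truncDist ℓ R x) := by
  have : Continuous (truncDist ℓ R x) := by unfold truncDist; fun_prop
  exact this.measurable

variable (p : ℝ≥0∞) [Fact (1 ≤ p)]

theorem measurable_norm_toLp {Ω : Type*} [MeasurableSpace Ω] {f : Ω → ι → ℝ}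
    (hf : ∀ i, Measurable fun x => f x i) :
    Measurable fun x => ‖(WithLp.toLp p (f x) : PiLp p fun _ : ι => ℝ)‖ :=
  ((PiLp.continuous_toLp p (fun _ : ι => ℝ)).norm.measurable).comp (measurable_pi_lambda _ hf)

theorem coordDist_le {ℓ : ι → ℝ} (hℓ : ∀ i, 0 ≤ ℓ i) (hℓ1 : ∑ i, ℓ i ≤ 1) {R : ℝ} (hR : 0 < R)
    (x z : ∀ i, M i) : coordDist p x z ≤ R * (coordGauge p ℓ R x z + 1) := by
  have h1 : coordDist p x z ≤ ‖(WithLp.toLp p (R • ((fun i => truncDist (ℓ i) R (x i) (z i)) + ℓ)) :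
      PiLp p fun _ : ι => ℝ)‖ := by
    refine PiLp.norm_toLp_mono p fun i => ?_
    rw [abs_of_nonneg dist_nonneg]
    refine le_trans ?_ (le_abs_self _)
    simp only [Pi.smul_apply, Pi.add_apply, smul_eq_mul]
    have h2 : dist (x i) (z i) / R - ℓ i ≤ truncDist (ℓ i) R (x i) (z i) := le_max_left _ _
    rw [sub_le_iff_le_add, div_le_iff₀ hR] at h2
    linarith
  refine h1.trans ?_
  rw [WithLp.toLp_smul, WithLp.toLp_add, norm_smul, Real.norm_of_nonneg hR.le]
  refine mul_le_mul_of_nonneg_left ((norm_add_le _ _).trans (add_le_add_right ?_ _)) hR.le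
  refine (PiLp.norm_toLp_le_sum p ℓ).trans ?_
  simpa only [abs_of_nonneg (hℓ _)] using hℓ1

/-- Moving the centre costs `d / R` by the triangle inequality. Changing the unit costs `|1/R -
1/R'|` times the distance from `x'` to `z`, which is at most `4R'` since the gauge is below `3`;
this is again at most `d / R`. -/
theorem coordGauge_le_add {ℓ : ι → ℝ} (hℓ : ∀ i, 0 ≤ ℓ i) (hℓ1 : ∑ i, ℓ i ≤ 1) {R R' : ℝ}
    (hR : 0 < R) (hR' : 0 < R') {x x' z : ∀ i, M i} (hRR' : |R' - R| ≤ coordDist p x x' / 4)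
    (hz : coordGauge p ℓ R' x' z < 3) :
    coordGauge p ℓ R x z ≤ coordGauge p ℓ R' x' z + 2 * (coordDist p x x' / R) := by
  let u : ι → ℝ := fun i => truncDist (ℓ i) R' (x' i) (z i)
  let v : ι → ℝ := fun i => dist (x i) (x' i)
  let w : ι → ℝ := fun i => dist (x' i) (z i)
  have hd : 0 ≤ coordDist p x x' := norm_nonneg _
  have h1 : coordGauge p ℓ R x z ≤ ‖(WithLp.toLp p (u + ((1 / R) • v + (|R' - R| / (R * R')) • w)) :
      PiLp p fun _ : ι => ℝ)‖ := by
    refine PiLp.norm_toLp_mono p fun i => ?_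
    rw [abs_of_nonneg (truncDist_nonneg _ _ _ _)]
    refine le_trans ?_ (le_abs_self _)
    simp only [Pi.smul_apply, Pi.add_apply, smul_eq_mul]
    have hu0 : 0 ≤ u i := truncDist_nonneg _ _ _ _
    have hv0 : 0 ≤ v i := dist_nonneg
    have hw0 : 0 ≤ w i := dist_nonneg
    have hc0 : 0 ≤ |R' - R| / (R * R') := by positivity
    refine max_le ?_ (by positivity)
    have h2 : w i / R' - ℓ i ≤ u i := le_max_left _ _
    have h3 : dist (x i) (z i) ≤ v i + w i := dist_triangle _ _ _
    have h4 : w i / R - w i / R' ≤ |R' - R| / (R * R') * w i := by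
      have h5 : w i / R - w i / R' = (R' - R) / (R * R') * w i := by field_simp
      rw [h5]
      gcongr
      exact le_abs_self _
    have h6 : dist (x i) (z i) / R ≤ v i / R + w i / R := by
      rw [← add_div]; gcongr
    have h7 : 1 / R * v i = v i / R := by ring
    linarith
  refine h1.trans ?_
  rw [WithLp.toLp_add, WithLp.toLp_add, WithLp.toLp_smul, WithLp.toLp_smul]
  refine (norm_add_le _ _).trans (add_le_add_right ((norm_add_le _ _).trans ?_) _)
  rw [norm_smul, norm_smul, Real.norm_of_nonneg (by positivity : 0 ≤ 1 / R),
    Real.norm_of_nonneg (by positivity : 0 ≤ |R' - R| / (R * R'))]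
  have h8 : ‖(WithLp.toLp p w : PiLp p fun _ : ι => ℝ)‖ ≤ R' * 4 :=
    (coordDist_le p hℓ hℓ1 hR' x' z).trans (by gcongr; linarith)
  have h9 : |R' - R| / (R * R') * ‖(WithLp.toLp p w : PiLp p fun _ : ι => ℝ)‖ ≤
      coordDist p x x' / R := by
    calc _ ≤ (coordDist p x x' / 4) / (R * R') * (R' * 4) := by gcongr
      _ = _ := by field_simp
  have h10 : 1 / R * ‖(WithLp.toLp p v : PiLp p fun _ : ι => ℝ)‖ = coordDist p x x' / R := by
    rw [one_div_mul_eq_div]; rfl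
  linarith

variable [∀ i, MeasurableSpace (M i)] [∀ i, BorelSpace (M i)] {μ : ∀ i, M i → Measure (M i)}

theorem measurable_coordGauge (ℓ : ι → ℝ) (R : ℝ) (x : ∀ i, M i) : Measurable (coordGauge p ℓ R x) :=
  measurable_norm_toLp p fun i =>
    (measurable_truncDist (ℓ i) R (x i)).comp (measurable_pi_apply i)

theorem hasGrowth_coordGauge (hμ : ∀ i, IsPointwiseHomogeneous (μ i)) {ℓ : ι → ℝ}
    (hℓ : ∀ i, 0 ≤ ℓ i) {b : ℝ}
    (hb : (∏ i, (doublingConst (μ i)).toReal) ^ 2 ≤ Real.exp (2 * b) - 1)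
    {R : ℝ} (hR : 0 < R) (x : ∀ i, M i) :
    HasGrowth b (Measure.pi fun i => μ i (x i)) (coordGauge p ℓ R x) := by
  have hσ : ∀ i, SigmaFinite (μ i (x i)) := fun i => (hμ i).sigmaFinite (x i)
  refine ⟨measurable_coordGauge p ℓ R x, ?_, ?_, ?_⟩
  · have hsub : Set.univ.pi (fun i => ball (x i) (R * (1 / (Fintype.card ι + 1)))) ⊆
        {z | coordGauge p ℓ R x z < 1} := by
      intro z hz
      refine (PiLp.norm_toLp_le_sum p _).trans_lt ?_
      have hterm : ∀ i, |truncDist (ℓ i) R (x i) (z i)| ≤ 1 / (Fintype.card ι + 1) := by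
        intro i
        rw [abs_of_nonneg (truncDist_nonneg _ _ _ _)]
        refine max_le ?_ (by positivity)
        have h1 := mem_ball'.1 (hz i trivial)
        have h2 : dist (x i) (z i) / R ≤ 1 / (Fintype.card ι + 1) := by
          rw [div_le_iff₀ hR, mul_comm]; exact h1.le
        linarith [hℓ i]
      refine (Finset.sum_le_sum fun i _ => hterm i).trans_lt ?_
      rw [Finset.sum_const, Finset.card_univ, nsmul_eq_mul, mul_one_div, div_lt_one (by positivity)]
      linarith
    refine lt_of_lt_of_le ?_ (measure_mono hsub)
    rw [Measure.pi_pi]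
    refine CanonicallyOrderedAdd.prod_pos.2 fun i _ => ?_
    exact ((hμ i).doublingAt (x i)).pos _ (by positivity)
  · have hsub : {z | coordGauge p ℓ R x z < 4} ⊆
        Set.univ.pi (fun i => ball (x i) (R * (4 + ℓ i))) := by
      intro z hz i _
      rw [← truncDist_lt_iff hR four_pos]
      refine lt_of_le_of_lt ?_ (show coordGauge p ℓ R x z < 4 from hz)
      exact (le_abs_self _).trans (PiLp.norm_apply_le
        (WithLp.toLp p fun i => truncDist (ℓ i) R (x i) (z i) : PiLp p fun _ : ι => ℝ) i)
    refine (measure_mono hsub).trans_lt ?_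
    rw [Measure.pi_pi]
    exact ENNReal.prod_lt_top fun i _ => ((hμ i).doublingAt (x i)).finite _
      (mul_pos hR (by linarith [hℓ i]))
  -- By homogeneity of the norm, growth from level `1` to level `4` becomes a coordinatewise
  -- comparison at equal levels. Each coordinate then costs two doublings, since `4s + ℓ ≤ 4 (s +
  -- ℓ)`.
  · have hquarter : {z | coordGauge p ℓ R x z < 4} = {z : ∀ i, M i |
        ‖(WithLp.toLp p fun i => (1 / 4 : ℝ) * truncDist (ℓ i) R (x i) (z i) :
          PiLp p fun _ : ι => ℝ)‖ < 1} := by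
      ext z
      have : (WithLp.toLp p fun i => (1 / 4 : ℝ) * truncDist (ℓ i) R (x i) (z i) :
          PiLp p fun _ : ι => ℝ) =
          (1 / 4 : ℝ) • WithLp.toLp p fun i => truncDist (ℓ i) R (x i) (z i) := rfl
      simp only [Set.mem_ofPred_eq, this, norm_smul, coordGauge]
      rw [Real.norm_of_nonneg (by norm_num)]
      constructor <;> intro h <;> linarith
    have hne : ∀ i, doublingConst (μ i) ^ 2 ≠ ⊤ := fun i =>
      ENNReal.pow_ne_top (hμ i).uniform_doubling.ne
    have key := pi_sublevel_le p (η := fun i => μ i (x i)) (ν := fun i => μ i (x i))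
      (c := fun i => doublingConst (μ i) ^ 2) hne
      (t' := fun i z => (1 / 4 : ℝ) * truncDist (ℓ i) R (x i) z)
      (t := fun i z => truncDist (ℓ i) R (x i) z)
      (fun i => (measurable_truncDist _ _ _).const_mul _) (fun i => measurable_truncDist _ _ _)
      (fun i y => mul_nonneg (by norm_num) (truncDist_nonneg _ _ _ _))
      (fun i y => truncDist_nonneg _ _ _ _) (by
        intro i s hs
        have e1 : {y | truncDist (ℓ i) R (x i) y < s} = ball (x i) (R * (s + ℓ i)) :=
          Set.ext fun y => truncDist_lt_iff hR hs _ _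
        have e2 : {y | (1 / 4 : ℝ) * truncDist (ℓ i) R (x i) y < s} ⊆
            ball (x i) (2 ^ 2 * (R * (s + ℓ i))) := by
          intro y hy
          have h1 : (1 / 4 : ℝ) * truncDist (ℓ i) R (x i) y < s := hy
          have h2 := (truncDist_lt_iff hR (by linarith : 0 < 4 * s) (x i) y).1 (by linarith)
          refine ball_subset_ball ?_ h2
          nlinarith [mul_nonneg hR.le (hℓ i)]
        rw [e1]
        exact (measure_mono e2).trans ((hμ i).measure_ball_pow_le (x i)
          (mul_pos hR (by linarith [hℓ i])) 2)) 1
    rw [hquarter]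
    refine key.trans (mul_le_mul_left ?_ _)
    rw [Finset.prod_pow, ← ENNReal.ofReal_toReal (ENNReal.prod_lt_top fun i _ =>
      (hμ i).uniform_doubling).ne, ENNReal.toReal_prod, ← ENNReal.ofReal_pow
      (Finset.prod_nonneg fun i _ => ENNReal.toReal_nonneg)]
    exact ENNReal.ofReal_le_ofReal hb

/-- The factors multiply to `∏ (1 + a i) ≤ e^A ≤ 1 + 2A`, so only the sum of the coordinate errors
enters, not the number of coordinates. -/
theorem pi_coordGauge_le {x : ∀ i, M i} {η : ∀ i, Measure (M i)} [∀ i, SigmaFinite (η i)]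
    [∀ i, SigmaFinite (μ i (x i))] {ℓ : ι → ℝ} {R : ℝ} (hR : 0 < R) {a : ι → ℝ}
    (ha : ∀ i, 0 ≤ a i) {A : ℝ} (hA : ∑ i, a i ≤ A) (hA1 : A ≤ 1)
    (hη : ∀ i s, 0 < s → η i (ball (x i) (R * (s + ℓ i))) ≤
      ENNReal.ofReal (1 + a i) * μ i (x i) (ball (x i) (R * (s + ℓ i)))) (s : ℝ) :
    Measure.pi η {z | coordGauge p ℓ R x z < s} ≤
      ENNReal.ofReal (1 + 2 * A) * Measure.pi (fun i => μ i (x i)) {z | coordGauge p ℓ R x z < s} := by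
  refine (pi_sublevel_le p (η := η) (ν := fun i => μ i (x i))
    (c := fun i => ENNReal.ofReal (1 + a i)) (fun i => ENNReal.ofReal_ne_top)
    (t' := fun i => truncDist (ℓ i) R (x i)) (t := fun i => truncDist (ℓ i) R (x i))
    (fun i => measurable_truncDist _ _ _) (fun i => measurable_truncDist _ _ _)
    (fun i y => truncDist_nonneg _ _ _ _) (fun i y => truncDist_nonneg _ _ _ _)
    (fun i s hs => ?_) s).trans (mul_le_mul_left ?_ _)
  · simp only [truncDist_lt_iff hR hs]
    exact hη i s hs
  · rw [← ENNReal.ofReal_prod_of_nonneg fun i _ => by linarith [ha i]]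
    refine ENNReal.ofReal_le_ofReal ?_
    have hA0 : 0 ≤ A := (Finset.sum_nonneg fun i _ => ha i).trans hA
    calc ∏ i, (1 + a i) ≤ ∏ i, Real.exp (a i) :=
          Finset.prod_le_prod (fun i _ => by linarith [ha i]) fun i _ => by
            linarith [Real.add_one_le_exp (a i)]
      _ = Real.exp (∑ i, a i) := (Real.exp_sum _ _).symm
      _ ≤ Real.exp A := Real.exp_le_exp.2 hA
      _ ≤ 1 + 2 * A := by
          have h2 := Real.abs_exp_sub_one_le (x := A) (by rwa [abs_of_nonneg hA0])
          rw [abs_of_nonneg hA0] at h2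
          linarith [le_abs_self (Real.exp A - 1)]

end Gauge

/-! ### The extension constant of a product -/

theorem extensionConst_empty (𝕜 : Type*) {Y : Type*} (X : Type*) [RCLike 𝕜] [MetricSpace Y]
    [NormedAddCommGroup X] [NormedSpace 𝕜 X] : extensionConst 𝕜 X (∅ : Set Y) = 0 := by
  refine le_antisymm ?_ zero_le
  refine (iInf₂_le (0 : Lip 𝕜 (∅ : Set Y) X →L[𝕜] Lip 𝕜 Y X) fun f s => s.2.elim).trans ?_
  simp

theorem ENNReal.one_le_of_one_div_add_one_div {p q : ℝ≥0∞} (h : 1 / p + 1 / q = 1) : 1 ≤ q := by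
  have h1 : 1 / q ≤ 1 / p + 1 / q := le_add_self
  rwa [h, one_div, ENNReal.inv_le_one] at h1

theorem one_le_prod_of_one_le {ι : Type*} [Fintype ι] {a : ι → ℝ} (h : ∀ i, 1 ≤ a i) :
    1 ≤ ∏ i, a i := by
  simpa using Finset.prod_le_prod (s := Finset.univ) (f := fun _ => (1 : ℝ))
    (fun i _ => zero_le_one) fun i _ => h i

theorem IsPointwiseHomogeneous.one_le_toReal_doublingConst {M : Type*} [MetricSpace M]
    [MeasurableSpace M] {μ : M → Measure M} (h : IsPointwiseHomogeneous μ) (x : M) :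
    1 ≤ (doublingConst μ).toReal := by
  simpa using ENNReal.toReal_mono h.uniform_doubling.ne (h.one_le_doublingConst x)

theorem IsPointwiseHomogeneous.half_le_logb_doublingConst {M : Type*} [MetricSpace M]
    [MeasurableSpace M] [BorelSpace M] {μ : M → Measure M} (h : IsPointwiseHomogeneous μ)
    {x y : M} (hxy : x ≠ y) : 1 / 2 ≤ Real.logb 2 (doublingConst μ).toReal := by
  have h1 : (2 : ℝ) ≤ (doublingConst μ).toReal ^ 2 := by
    have h2 := ENNReal.toReal_mono (ENNReal.pow_ne_top h.uniform_doubling.ne)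
      (h.two_le_sq_doublingConst hxy)
    simpa [ENNReal.toReal_pow] using h2
  have h3 : Real.logb 2 2 ≤ Real.logb 2 ((doublingConst μ).toReal ^ 2) :=
    Real.logb_le_logb_of_le one_lt_two two_pos h1
  rw [Real.logb_self_eq_one one_lt_two, Real.logb_pow] at h3
  push_cast at h3
  linarith

/-- This is where truncation pays off: the bound is uniform in `s`, because distinct points force
`log₂ D ≥ 1/2`, while for `x = y` there is nothing to bound. -/
theorem IsPointwiseHomogeneous.consistencyConst_mul_dist_div_le {M : Type*} [MetricSpace M]
    [MeasurableSpace M] [BorelSpace M] {μ : M → Measure M} (h : IsPointwiseHomogeneous μ)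
    {x y : M} {n : ℝ} (hn : 0 < n) {R s : ℝ} (hR : 0 < R) (hs : 0 < s) :
    consistencyConst μ * dist x y / (R * (s + Real.logb 2 (doublingConst μ).toReal / n)) ≤
      2 * n * (consistencyConst μ * dist x y) / R := by
  rcases eq_or_ne x y with rfl | hxy
  · simp
  have h1 := h.half_le_logb_doublingConst hxy
  have h2 : 1 / (2 * n) ≤ s + Real.logb 2 (doublingConst μ).toReal / n := by
    have h3 : 1 / (2 * n) ≤ Real.logb 2 (doublingConst μ).toReal / n := by
      rw [← div_div]; gcongr
    linarith
  have h4 : 0 ≤ (consistencyConst μ : ℝ) * dist x y := by positivity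
  calc _ ≤ consistencyConst μ * dist x y / (R * (1 / (2 * n))) := by gcongr
    _ = _ := by field_simp

/-- The equivalence `e` lets one statement serve both the `p`-sum and a single space, viewed as a
product with one factor. -/
theorem extensionConst_le_of_pi {ι : Type*} [Fintype ι] {M : ι → Type*} [∀ i, MetricSpace (M i)]
    [∀ i, MeasurableSpace (M i)] [∀ i, BorelSpace (M i)] {μ : ∀ i, M i → Measure (M i)}
    (hμ : ∀ i, IsPointwiseHomogeneous (μ i)) {p q : ℝ≥0∞} [Fact (1 ≤ p)]
    (hpq : 1 / p + 1 / q = 1) {Y : Type*} [MetricSpace Y] (e : Y ≃ ∀ i, M i)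
    (he : ∀ y y', dist y y' = coordDist p (e y) (e y'))
    (𝕜 : Type*) [RCLike 𝕜] (X : Type*) [NormedAddCommGroup X] [NormedSpace 𝕜 X]
    [CompleteSpace X] (S : Set Y) :
    extensionConst 𝕜 X S ≤ ENNReal.ofReal
      (7000 * (‖(WithLp.toLp q fun i => (consistencyConst (μ i) : ℝ) : PiLp q fun _ : ι => ℝ)‖ + 1) *
        (Real.logb 2 (∏ i, (doublingConst (μ i)).toReal) + 1)) := by
  rcases S.eq_empty_or_nonempty with rfl | hS
  · rw [extensionConst_empty]; exact zero_le
  have hq1 : Fact (1 ≤ q) := ⟨ENNReal.one_le_of_one_div_add_one_div hpq⟩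
  set C := ‖(WithLp.toLp q fun i => (consistencyConst (μ i) : ℝ) : PiLp q fun _ : ι => ℝ)‖
  have hC : 0 ≤ C := norm_nonneg _
  -- A base point makes every factor nonempty; over an empty factor the doubling constant would be
  -- `0`.
  obtain ⟨y₀, -⟩ := id hS
  have hD1 : ∀ i, 1 ≤ (doublingConst (μ i)).toReal := fun i =>
    (hμ i).one_le_toReal_doublingConst (e y₀ i)
  set D := ∏ i, (doublingConst (μ i)).toReal with hD
  have hDpos : 1 ≤ D := one_le_prod_of_one_le hD1
  set n := Real.logb 2 D + 1 with hn
  have hn1 : 1 ≤ n := by linarith [Real.logb_nonneg one_lt_two hDpos]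
  have hn0 : 0 < n := by linarith
  let ℓ : ι → ℝ := fun i => Real.logb 2 (doublingConst (μ i)).toReal / n
  have hℓ : ∀ i, 0 ≤ ℓ i := fun i => div_nonneg (Real.logb_nonneg one_lt_two (hD1 i)) hn0.le
  have hℓ1 : ∑ i, ℓ i ≤ 1 := by
    simp only [ℓ]
    rw [← Finset.sum_div, div_le_one hn0, ← Real.logb_prod _ _ fun i _ =>
      (zero_lt_one.trans_le (hD1 i)).ne']
    linarith
  have hb : D ^ 2 ≤ Real.exp (2 * n) - 1 := by
    have h1 : D ≤ Real.exp (n - 1) := by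
      rw [← Real.exp_log (by linarith : 0 < D)]
      refine Real.exp_le_exp.2 ?_
      have h2 : Real.log D = (n - 1) * Real.log 2 := by
        rw [hn, add_sub_cancel_right, Real.logb, div_mul_cancel₀ _ (Real.log_pos one_lt_two).ne']
      rw [h2]
      nlinarith [Real.log_two_lt_d9]
    have h3 : D ^ 2 ≤ Real.exp (2 * (n - 1)) := by
      calc D ^ 2 ≤ Real.exp (n - 1) ^ 2 := by gcongr
        _ = _ := by rw [← Real.exp_nat_mul]; norm_num
    have h4 : Real.exp (2 * n) = Real.exp (2 * (n - 1)) * Real.exp 2 := by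
      rw [← Real.exp_add]; ring_nf
    have h5 : 1 ≤ Real.exp (2 * (n - 1)) := Real.one_le_exp (by linarith)
    have h6 : 2 + 1 ≤ Real.exp 2 := Real.add_one_le_exp 2
    rw [h4]
    nlinarith
  -- The kernel lives on `{σ < 3}`, hence within `4R` of `y`, which must be `infDist y S / 4`.
  let R : Y → ℝ := fun y => infDist y S / 16
  let σ : Y → (∀ i, M i) → ℝ := fun y => coordGauge p ℓ (R y) (e y)
  let ν : Y → Measure (∀ i, M i) := fun y => Measure.pi fun i => μ i (e y i)
  have hpos : ∀ y ∉ closure S, 0 < infDist y S := fun y hy => by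
    rw [← infDist_closure]
    exact (isClosed_closure.notMem_iff_infDist_pos hS.closure).1 hy
  have hR : ∀ y ∉ closure S, 0 < R y := fun y hy => div_pos (hpos y hy) (by norm_num)
  have hgrowth : ∀ y ∉ closure S, HasGrowth n (ν y) (σ y) := fun y hy =>
    hasGrowth_coordGauge p hμ hℓ hb (hR y hy) (e y)
  have hloc : ∀ y (x : ∀ i, M i), dist y (e.symm x) = coordDist p (e y) x := fun y x => by
    rw [he, e.apply_symm_apply]
  refine (extensionConst_le_of_kernels (𝕜 := 𝕜) (X := X) hS e.symm (fun y r => ?_)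
    (fun y => decayKernel n (ν y) (σ y)) (fun y hy => (hgrowth y hy).decayKernel_univ hn0)
    (fun y hy => ?_) (Λ := n * (96 * C + 384)) (by positivity) ?_).trans ?_
  · simp only [hloc]
    refine measurableSet_lt (measurable_norm_toLp p fun i => ?_) measurable_const
    exact (continuous_const.dist continuous_id).measurable.comp (measurable_pi_apply i)
  · refine measure_mono_null (fun x hx => ?_) (hgrowth y hy).decayKernel_eq_zero
    by_contra hlt
    refine hx ?_
    change dist y (e.symm x) < _
    have h1 : σ y x < 3 := not_le.1 hlt
    rw [hloc]
    have h2 := coordDist_le p hℓ hℓ1 (hR y hy) (e y) x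
    have h3 : R y * (σ y x + 1) < R y * 4 := mul_lt_mul_of_pos_left (by linarith) (hR y hy)
    have h4 : R y * 4 = infDist y S / 4 := by simp only [R]; ring
    exact h2.trans_lt (h4 ▸ h3)
  · intro y hy y' hy' hyy'
    have hr := hpos y hy
    set d := dist y y' with hd
    have hd0 : 0 ≤ d := dist_nonneg
    have hr1 : infDist y S ≤ infDist y' S + d := infDist_le_infDist_add_dist
    have hr2 : infDist y' S ≤ infDist y S + d := by
      rw [hd, dist_comm]; exact infDist_le_infDist_add_dist
    have hRy := hR y hy
    have hRy' := hR y' hy'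
    have hRR : R y ≤ 4 / 3 * R y' := by simp only [R]; linarith
    have habs : |R y' - R y| ≤ d / 4 := by
      rw [abs_le]; simp only [R]; constructor <;> linarith
    have hinv : 1 / R y' ≤ (4 / 3) * (1 / R y) := by
      rw [mul_one_div, div_le_div_iff₀ hRy' hRy]
      linarith
    have hinvy : 1 / R y = 16 / infDist y S := by simp only [R]; field_simp
    have hdy : coordDist p (e y) (e y') = d := (he y y').symm
    have hdy' : coordDist p (e y') (e y) = d := by rw [← he, dist_comm]
    have hq0 : 0 ≤ d / R y := by positivity
    have hq' : d / R y' ≤ 4 / 3 * (d / R y) := by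
      have := mul_le_mul_of_nonneg_left hinv hd0
      rw [mul_one_div] at this
      refine this.trans (le_of_eq ?_)
      ring
    -- The gauge shift is `2d/R` at `y` and `2d/R' ≤ (8/3) d/R` at `y'`, so `3` covers both. The
    -- same factor `4/3` turns the consistency error `2n` into `3n`, doubled to `6n` by
    -- `pi_coordGauge_le`.
    have hbound := exists_common_bound (b := n) (t := 3 * (d / R y)) (ε := 6 * n * C * (d / R y))
      hn1 (by positivity) (by positivity) (hgrowth y hy) (hgrowth y' hy') ?_ ?_ ?_
    · obtain ⟨G, h1, h2, h3⟩ := hbound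
      refine ⟨G, h1, h2, h3.trans (ENNReal.ofReal_le_ofReal (le_of_eq ?_))⟩
      have : d / R y = 16 * d / infDist y S := by
        rw [div_eq_mul_one_div, hinvy]; ring
      rw [this]
      field_simp
      ring
    · intro hε
      choose η hη hη1 hη2 hη3 hη4 using fun i => (hμ i).exists_upper_measure (e y i) (e y' i)
      have hs1 : ∀ i, SigmaFinite (μ i (e y i)) := fun i => (hμ i).sigmaFinite _
      have hs2 : ∀ i, SigmaFinite (μ i (e y' i)) := fun i => (hμ i).sigmaFinite _
      let a : ι → ℝ := fun i =>
        3 * n / R y * (consistencyConst (μ i) * dist (e y i) (e y' i))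
      have ha : ∀ i, 0 ≤ a i := fun i => by positivity
      have hsum : ∑ i, a i ≤ 3 * n * C * (d / R y) := by
        simp only [a]
        rw [← Finset.mul_sum]
        have := PiLp.sum_mul_le_norm_mul_norm p hpq
          (x := fun i => (consistencyConst (μ i) : ℝ)) (y := fun i => dist (e y i) (e y' i))
          fun i => dist_nonneg
        calc _ ≤ 3 * n / R y * (C * coordDist p (e y) (e y')) := by gcongr; exact this
          _ = _ := by rw [hdy]; ring
      have hε' : (6 : ℝ) * n * C * (d / R y) = 2 * (3 * n * C * (d / R y)) := by ring
      have hA1 : 3 * n * C * (d / R y) ≤ 1 := by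
        rw [hε'] at hε
        have : 0 ≤ 3 * n * C * (d / R y) := by positivity
        linarith
      rw [hε']
      refine ⟨Measure.pi η, Measure.pi_le_pi hη1, Measure.pi_le_pi hη2, fun s _ _ => ?_,
        fun s _ _ => ?_⟩
      · refine pi_coordGauge_le p hRy ha hsum hA1 (fun i s hs => ?_) s
        refine (hη3 i _ (mul_pos hRy (add_pos_of_pos_of_nonneg hs (hℓ i)))).trans
          (mul_le_mul_left (ENNReal.ofReal_le_ofReal (add_le_add_right ?_ _)) _)
        refine ((hμ i).consistencyConst_mul_dist_div_le hn0 hRy hs).trans ?_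
        have hc : 0 ≤ n / R y * (consistencyConst (μ i) * dist (e y i) (e y' i)) := by positivity
        have e1 : 2 * n * (consistencyConst (μ i) * dist (e y i) (e y' i)) / R y =
          2 * (n / R y * (consistencyConst (μ i) * dist (e y i) (e y' i))) := by ring
        have e2 : a i = 3 * (n / R y * (consistencyConst (μ i) * dist (e y i) (e y' i))) := by
          simp only [a]; ring
        rw [e1, e2]
        linarith
      · refine pi_coordGauge_le p hRy' ha hsum hA1 (fun i s hs => ?_) s
        refine (hη4 i _ (mul_pos hRy' (add_pos_of_pos_of_nonneg hs (hℓ i)))).trans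
          (mul_le_mul_left (ENNReal.ofReal_le_ofReal (add_le_add_right ?_ _)) _)
        refine ((hμ i).consistencyConst_mul_dist_div_le hn0 hRy' hs).trans ?_
        have hc : 0 ≤ n * (consistencyConst (μ i) * dist (e y i) (e y' i)) := by positivity
        have e1 : 2 * n * (consistencyConst (μ i) * dist (e y i) (e y' i)) / R y' =
          2 * (n * (consistencyConst (μ i) * dist (e y i) (e y' i)) * (1 / R y')) := by ring
        have e2 : a i = 3 * (n * (consistencyConst (μ i) * dist (e y i) (e y' i)) * (1 / R y)) := by
          simp only [a]; ring
        rw [e1, e2]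
        have h5 := mul_le_mul_of_nonneg_left hinv hc
        have h6 : 0 ≤ n * (consistencyConst (μ i) * dist (e y i) (e y' i)) * (1 / R y) := by
          positivity
        linarith
    · intro x hx
      have := coordGauge_le_add p hℓ hℓ1 hRy hRy' (x := e y) (by rw [hdy]; exact habs) hx
      rw [hdy] at this
      exact this.trans (by linarith)
    · intro x hx
      have := coordGauge_le_add p hℓ hℓ1 hRy' hRy (x := e y')
        (by rw [hdy', abs_sub_comm]; exact habs) hx
      rw [hdy'] at this
      exact this.trans (by linarith)
  · refine ENNReal.ofReal_le_ofReal ?_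
    nlinarith [mul_nonneg hC hn0.le]

end

theorem mainTheorem3 :
    ∃ c₀ : ℝ, 0 < c₀ ∧
      -- finite direct `p`-sums of spaces with uniform families of measures
      (∀ (N : ℕ) (M : Fin N → Type u) [∀ i, MetricSpace (M i)] [∀ i, MeasurableSpace (M i)]
          [∀ i, BorelSpace (M i)] (μ : ∀ i, M i → Measure (M i)) (K : Fin N → ℝ≥0)
          (p q : ℝ≥0∞) [Fact (1 ≤ p)]
          (𝕜 : Type w) [RCLike 𝕜] (X : Type v) [NormedAddCommGroup X] [NormedSpace 𝕜 X]
          [CompleteSpace X] (S : Set (PiLp p M)),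
          1 / p + 1 / q = 1 →
          (∀ i, IsPointwiseHomogeneous (μ i)) →
          (∀ i, 1 ≤ K i) →
          (∀ i, IsUniformFamily (μ i) (K i)) →
          extensionConst 𝕜 X S ≤
            ENNReal.ofReal
              (c₀ *
                (‖(WithLp.toLp q fun i => (consistencyConst (μ i) : ℝ) :
                    PiLp q fun _ : Fin N => ℝ)‖ * (∏ i, (K i : ℝ)) + 1) *
                (Real.logb 2 (∏ i, (doublingConst (μ i)).toReal) + 1))) ∧
      -- a single space, without uniformity of the family of measures
      (∀ (M : Type u) [MetricSpace M] [MeasurableSpace M] [BorelSpace M] (μ : M → Measure M)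
          (𝕜 : Type w) [RCLike 𝕜] (X : Type v) [NormedAddCommGroup X] [NormedSpace 𝕜 X]
          [CompleteSpace X] (S : Set M),
          IsPointwiseHomogeneous μ →
          extensionConst 𝕜 X S ≤
            ENNReal.ofReal
              (c₀ * ((consistencyConst μ : ℝ) + 1) *
                (Real.logb 2 (doublingConst μ).toReal + 1))) := by
  refine ⟨7000, by norm_num, ?_, ?_⟩
  · intro N M _ _ _ μ K p q _ 𝕜 _ X _ _ _ S hpq hμ hK _
    rcases S.eq_empty_or_nonempty with rfl | ⟨y₀, -⟩
    · rw [extensionConst_empty]; exact zero_le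
    refine (extensionConst_le_of_pi hμ hpq (WithLp.equiv p _)
      (fun y y' => PiLp.dist_eq_norm_toLp p y y') 𝕜 X S).trans (ENNReal.ofReal_le_ofReal ?_)
    have hq1 : Fact (1 ≤ q) := ⟨ENNReal.one_le_of_one_div_add_one_div hpq⟩
    have hD : 1 ≤ ∏ i, (doublingConst (μ i)).toReal := one_le_prod_of_one_le fun i =>
      (hμ i).one_le_toReal_doublingConst (y₀ i)
    have hlog := Real.logb_nonneg one_lt_two hD
    have hKprod : 1 ≤ ∏ i, (K i : ℝ) := one_le_prod_of_one_le fun i => by exact_mod_cast hK i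
    gcongr
    exact le_mul_of_one_le_right (norm_nonneg _) hKprod
  · intro M _ _ _ μ 𝕜 _ X _ _ _ S hμ
    -- With one coordinate every `p` gives the same metric; `p = 1`, `q = ⊤` makes both norms easy
    -- to evaluate.
    have h := extensionConst_le_of_pi (ι := Fin 1) (M := fun _ => M) (μ := fun _ => μ)
      (p := 1) (q := ⊤) (fun _ => hμ) (by simp) (Equiv.funUnique (Fin 1) M).symm
      (fun y y' => by
        rw [coordDist, PiLp.norm_eq_of_L1]
        simp) 𝕜 X S
    rw [PiLp.norm_eq_ciSup] at h
    simpa using h
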